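/- Let $N\ge 1$, $T_L,T_R>0$, and let $f$ be a rate function on $(0,\infty)^2$ that is $C^1$, strictly positive, non-decreasing in each variable, and bounded by a constant $K<\infty$. Fix an initial energy profile $\Theta_0\in(0,\infty)^N$. For each integer $M\ge 2$ let $\Phi^M$ be the following Markov jump process on energy profiles $E=(E_1,\dots,E_N)$ with $\Phi^M(0)=\Theta_0$. Write $E_0=T_L$, $E_{N+1}=T_R$, and $R(E)=\sum_{k=0}^N f(E_k,E_{k+1})$. Let $q_n,p_{1,n},p_{2,n},p_{3,n}$ (uniform on $(0,1)$) and $B_{1,n},B_{2,n}$ (Beta with parameters $1,M-1$), $n\ge 0$, be mutually independent. If $\Phi^M$ is in state $E$ after its $n$-th jump, at time $t_n$ (with $t_0=0$), then the next jump occurs at $t_{n+1}=t_n-R(E)^{-1}\log(1-q_n)$. In this jump clock $k\in\{0,\dots,N\}$ is chosen when $\sum_{j<k}f(E_j,E_{j+1})\le p_{1,n}R(E)<\sum_{j\le k}f(E_j,E_{j+1})$, and then the energy $$J_k=(1-p_{3,n})B_{1,n}\hat E_k-p_{3,n}B_{2,n}\hat E_{k+1}$$ is moved from position $k$ to position $k+1$,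 that is, it is subtracted from $E_k$ if $k\ge1$ and added to $E_{k+1}$ if $k+1\le N$. Here $\hat E_j=E_j$ for $1\le j\le N$, while $\hat E_0=-T_L\log(1-p_{2,n})$ and $\hat E_{N+1}=-T_R\log(1-p_{2,n})$ are exponential bath energies with means $T_L$ and $T_R$. Let $\Theta^M(t)=\Phi^M(Mt)$ be the fast-scale process. The processes for different $M$ are defined on one probability space, with an arbitrary joint law. Then for every finite $T>0$ the nonlinear discrete heat equation $$\frac{d}{dt}\bar\Theta(t)=F(\bar\Theta(t)),\qquad \bar\Theta(0)=\Theta_0,$$ $$F_i(\bar\Theta)=\tfrac12 f(\bar\Theta_{i-1},\bar\Theta_i)(\bar\Theta_{i-1}-\bar\Theta_i)+\tfrac12 f(\bar\Theta_i,\bar\Theta_{i+1})(\bar\Theta_{i+1}-\bar\Theta_i),\quad 1\le i\le N,$$ with $\bar\Theta_0\equiv T_L$ and $\bar\Theta_{N+1}\equiv T_R$ at the boundary, has a solution on $[0,T]$ with values in $(0,\infty)^N$, and for every such solution $\bar\Theta$, almost surely, $$\lim_{M\to\infty}\Theta^M(t)=\bar\Theta(t)\quad\text{uniformly for } t\in[0,T].$$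 -/

import Mathlib

open MeasureTheory ProbabilityTheory Filter Topology

namespace EnergyExchange

noncomputable section

/-- The standing assumptions on the exchange rate `f (E₁, E₂)` of two cells with positive energies:
`f` is `C¹`, strictly positive, non-decreasing in each variable, and bounded.  Nothing is assumed
about the values of `f` outside the open quadrant. -/
structure IsRateFunction (f : ℝ → ℝ → ℝ) : Prop where
  contDiffOn : ContDiffOn ℝ 1 (Function.uncurry f) (Set.Ioi 0 ×ˢ Set.Ioi 0)
  pos : ∀ x y, 0 < x → 0 < y → 0 < f x y
  mono : ∀ x x' y y', 0 < x → 0 < y → x ≤ x' → y ≤ y' → f x y ≤ f x' y'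
  bounded : ∃ K : ℝ, ∀ x y, 0 < x → 0 < y → f x y < K

/-- The chain `a, E₁, …, E_N, b`: the entries of `E` preceded by `a` and followed by `b`.
Cell `i : Fin N` sits at position `i.castSucc.succ = i.succ.castSucc`. -/
def chain {N : ℕ} (a b : ℝ) (E : Fin N → ℝ) : Fin (N + 2) → ℝ :=
  Fin.cons (α := fun _ => ℝ) a (Fin.snoc (α := fun _ => ℝ) E b)

/-- The rate of clock `k`, `0 ≤ k ≤ N`, which governs the exchange between the positions `k` and
`k + 1` of the chain `T_L, E₁, …, E_N, T_R`. -/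
def clockRate {N : ℕ} (f : ℝ → ℝ → ℝ) (TL TR : ℝ) (E : Fin N → ℝ) (k : Fin (N + 1)) : ℝ :=
  f (chain TL TR E k.castSucc) (chain TL TR E k.succ)

/-- The total rate `R(E)` of all clocks. -/
def totalRate {N : ℕ} (f : ℝ → ℝ → ℝ) (TL TR : ℝ) (E : Fin N → ℝ) : ℝ :=
  ∑ k, clockRate f TL TR E k

/-- The six sources of randomness used in one step of the process: `hold` for the waiting time,
`clock` (`p₁`) for the clock that rings, `bath` (`p₂`) for the energy of the heat bath, `split`
(`p₃`) for the redistribution, `beta₁` and `beta₂` for the two exchanged fractions. -/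
inductive Source : Type
  | hold
  | clock
  | bath
  | split
  | beta₁
  | beta₂

/-- The distribution of each source: Beta with parameters `1, M - 1` for the exchanged fractions,
uniform on `(0, 1)` for the others. -/
def Source.law (M : ℕ) : Source → Measure ℝ
  | .hold => volume.restrict (Set.Ioo 0 1)
  | .clock => volume.restrict (Set.Ioo 0 1)
  | .bath => volume.restrict (Set.Ioo 0 1)
  | .split => volume.restrict (Set.Ioo 0 1)
  | .beta₁ => betaMeasure 1 ((M : ℝ) - 1)
  | .beta₂ => betaMeasure 1 ((M : ℝ) - 1)

/-- The driving noise with parameter `M`: the variables `ξ n s`, for all steps `n` and all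
sources `s`, are mutually independent and have the prescribed distributions. -/
structure IsNoise {Ω : Type*} [MeasurableSpace Ω] (P : Measure Ω) (M : ℕ)
    (ξ : ℕ → Source → Ω → ℝ) : Prop where
  hasLaw : ∀ n s, HasLaw (ξ n s) (s.law M) P
  indep : iIndepFun (fun x : ℕ × Source => ξ x.1 x.2) P

/-- Clock `k` is chosen by `u ∈ (0, 1)`: `∑_{j < k} f_j ≤ u R < ∑_{j ≤ k} f_j`. -/
def Chosen {N : ℕ} (f : ℝ → ℝ → ℝ) (TL TR : ℝ) (E : Fin N → ℝ) (u : ℝ) (k : Fin (N + 1)) : Prop :=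
  ∑ j ∈ Finset.Iio k, clockRate f TL TR E j ≤ u * totalRate f TL TR E ∧
    u * totalRate f TL TR E < ∑ j ∈ Finset.Iic k, clockRate f TL TR E j

/-- The flux `J_k = (1 - p) B₁ E_k - p B₂ E_{k+1}` from position `k` to position `k + 1`, where the
energies of the left and right heat bath are exponential with means `T_L` and `T_R`. -/
def flux {N : ℕ} (TL TR : ℝ) (E : Fin N → ℝ) (w : Source → ℝ) (k : Fin (N + 1)) : ℝ :=
  let E' := chain (-TL * Real.log (1 - w .bath)) (-TR * Real.log (1 - w .bath)) E
  (1 - w .split) * w .beta₁ * E' k.castSucc - w .split * w .beta₂ * E' k.succ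

open Classical in
/-- The increment `ζ(E, w)` of the energies in one step.  Cell `i` receives the flux of the clock
on its left if that clock is chosen, and loses the flux of the clock on its right if that one is. -/
def increment {N : ℕ} (f : ℝ → ℝ → ℝ) (TL TR : ℝ) (E : Fin N → ℝ) (w : Source → ℝ) :
    Fin N → ℝ := fun i =>
  (if Chosen f TL TR E (w .clock) i.castSucc then flux TL TR E w i.castSucc else 0) -
    (if Chosen f TL TR E (w .clock) i.succ then flux TL TR E w i.succ else 0)

/-- The energies after `n` exchanges, as a function of the realized noise `w`. -/
def jumpChain {N : ℕ} (f : ℝ → ℝ → ℝ) (TL TR : ℝ) (E₀ : Fin N → ℝ) (w : ℕ → Source → ℝ) :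
    ℕ → Fin N → ℝ
  | 0 => E₀
  | n + 1 => jumpChain f TL TR E₀ w n + increment f TL TR (jumpChain f TL TR E₀ w n) (w n)

/-- The time `t_n` of the `n`-th exchange on the slow scale:
`t_{n+1} - t_n = - R⁻¹ log (1 - q_n)` with `R` the total rate in the current state. -/
def jumpTime {N : ℕ} (f : ℝ → ℝ → ℝ) (TL TR : ℝ) (E₀ : Fin N → ℝ) (w : ℕ → Source → ℝ) :
    ℕ → ℝ
  | 0 => 0
  | n + 1 => jumpTime f TL TR E₀ w n -
      (totalRate f TL TR (jumpChain f TL TR E₀ w n))⁻¹ * Real.log (1 - w n .hold)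

/-- The slow-scale process: `Φ(t)` is the state after `n` exchanges when `t_n ≤ t < t_{n+1}`.
(The index is the largest `n` with `t_n ≤ t`; almost surely, only finitely many `n` qualify.) -/
def slowProcess {N : ℕ} (f : ℝ → ℝ → ℝ) (TL TR : ℝ) (E₀ : Fin N → ℝ) (w : ℕ → Source → ℝ)
    (t : ℝ) : Fin N → ℝ :=
  jumpChain f TL TR E₀ w (sSup {n : ℕ | jumpTime f TL TR E₀ w n ≤ t})

/-- The fast-scale process `Θ^M(t) = Φ^M(M t)`, in which every clock runs `M` times faster. -/
def fastProcess {N : ℕ} (f : ℝ → ℝ → ℝ) (TL TR : ℝ) (E₀ : Fin N → ℝ) (M : ℕ)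
    (w : ℕ → Source → ℝ) (t : ℝ) : Fin N → ℝ :=
  slowProcess f TL TR E₀ w (M * t)

/-- The right-hand side of the discrete heat equation,
`F_i = ½ f(E_{i-1}, E_i) (E_{i-1} - E_i) + ½ f(E_i, E_{i+1}) (E_{i+1} - E_i)`,
with `E₀ = T_L` and `E_{N+1} = T_R`. -/
def drift {N : ℕ} (f : ℝ → ℝ → ℝ) (TL TR : ℝ) (E : Fin N → ℝ) : Fin N → ℝ := fun i =>
  let left := chain TL TR E i.castSucc.castSucc
  let right := chain TL TR E i.succ.succ
  1 / 2 * f left (E i) * (left - E i) + 1 / 2 * f (E i) right * (right - E i)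

/-- `θ` solves the discrete heat equation on `[0, T]` with initial value `E₀`, inside the set of
positive energies, on which the rate function is given. -/
structure IsSolution {N : ℕ} (f : ℝ → ℝ → ℝ) (TL TR : ℝ) (E₀ : Fin N → ℝ) (T : ℝ)
    (θ : ℝ → Fin N → ℝ) : Prop where
  initial : θ 0 = E₀
  pos : ∀ t ∈ Set.Icc 0 T, ∀ i, 0 < θ t i
  deriv : ∀ t ∈ Set.Icc 0 T, HasDerivWithinAt θ (drift f TL TR (θ t)) (Set.Icc 0 T) t

end

end EnergyExchange

/-! A Beta(1, M-1) variable has mean 1/M, so one exchange moves energies by O(1/M), while on the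
fast scale the waiting time in state E is a standard exponential variable divided by M R(E).
Averaging over the clock (probability f_k / R), the split (mean 1/2), the exchanged fraction and the
bath energy shows that the mean increment is F(E) / (M R(E)), that is, F(E) times the mean waiting
time. The jump chain is therefore an Euler scheme for the heat equation, run with the actual random
waiting times as step lengths and perturbed by noise.

Two noises have to be controlled: `energyNoise`, the increment minus F(E) times the actual waiting
time, and `timeNoise`, the waiting time minus its mean. Both are centred given the past and of order
1/M. Both are set to 0 outside a box bounded away from 0; inside it the total rate is bounded below
and F is bounded, so the moment bounds are uniform in the state and no stopping time is needed.

Deterministic half: if all partial sums of both noises up to step c M are small, a discrete Gronwall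
argument (`euler_scheme_tracking`) keeps the chain in a tube around the solution, hence in the box
where the noises are the true deviations, and c M steps are enough to pass time T
(`IsSolution.exists_tracking`).

Probabilistic half: the sixth moment of a sum of at most c M noise terms is O(M⁻³)
(`lintegral_sum_pow_six_le`). Markov's inequality and a union bound over the c M partial sums leave
O(M⁻²), which is summable; the same union bound with fourth moments would leave only O(M⁻¹). The
Borel–Cantelli lemma then applies (`ae_eventually_abs_sum_le`). It needs no independence between
different M, which is why the joint law is arbitrary.

Existence follows from Picard–Lindelöf for a truncated field together with a maximum principle
(`exists_isSolution`). -/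

namespace EnergyExchange

noncomputable section

/-! ### The chain of cells between the two baths -/

section Chain

variable {N : ℕ}

@[simp] lemma chain_zero (a b : ℝ) (E : Fin N → ℝ) : chain a b E 0 = a := rfl

@[simp] lemma chain_last (a b : ℝ) (E : Fin N → ℝ) : chain a b E (Fin.last (N + 1)) = b := by
  rw [← Fin.succ_last]
  simp [chain]

@[simp] lemma chain_castSucc_succ (a b : ℝ) (E : Fin N → ℝ) (i : Fin N) :
    chain a b E i.castSucc.succ = E i := by
  simp [chain]

@[simp] lemma chain_succ_castSucc (a b : ℝ) (E : Fin N → ℝ) (i : Fin N) :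
    chain a b E i.succ.castSucc = E i := by
  rw [← Fin.succ_castSucc, chain_castSucc_succ]

/-- Every position of the chain is one of the two ends or a cell. -/
lemma position_cases (j : Fin (N + 2)) :
    j = 0 ∨ j = Fin.last (N + 1) ∨ ∃ i : Fin N, j = i.castSucc.succ := by
  refine Fin.cases (Or.inl rfl) (fun k => ?_) j
  refine Fin.lastCases (Or.inr (Or.inl (Fin.succ_last _))) (fun i => ?_) k
  exact Or.inr (Or.inr ⟨i, rfl⟩)

lemma chain_pos {a b : ℝ} {E : Fin N → ℝ} (ha : 0 < a) (hb : 0 < b) (hE : ∀ i, 0 < E i)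
    (j : Fin (N + 2)) : 0 < chain a b E j := by
  rcases position_cases j with rfl | rfl | ⟨i, rfl⟩ <;> simp [*]

lemma le_chain {a b c : ℝ} {E : Fin N → ℝ} (ha : c ≤ a) (hb : c ≤ b) (hE : ∀ i, c ≤ E i)
    (j : Fin (N + 2)) : c ≤ chain a b E j := by
  rcases position_cases j with rfl | rfl | ⟨i, rfl⟩ <;> simp [*]

lemma chain_le {a b c : ℝ} {E : Fin N → ℝ} (ha : a ≤ c) (hb : b ≤ c) (hE : ∀ i, E i ≤ c)
    (j : Fin (N + 2)) : chain a b E j ≤ c := by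
  rcases position_cases j with rfl | rfl | ⟨i, rfl⟩ <;> simp [*]

lemma contDiff_chain (a b : ℝ) (j : Fin (N + 2)) :
    ContDiff ℝ 1 (fun E : Fin N → ℝ => chain a b E j) := by
  rcases position_cases j with rfl | rfl | ⟨i, rfl⟩
  · simpa using contDiff_const
  · simpa using contDiff_const
  · simpa using contDiff_apply ℝ ℝ i

lemma measurable_chain {α : Type*} [MeasurableSpace α] {g h : α → ℝ} {X : α → Fin N → ℝ}
    (hg : Measurable g) (hh : Measurable h) (hX : Measurable X) (j : Fin (N + 2)) :
    Measurable (fun x => chain (g x) (h x) (X x) j) := by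
  rcases position_cases j with rfl | rfl | ⟨i, rfl⟩
  · simpa only [chain_zero]
  · simpa only [chain_last]
  · simp only [chain_castSucc_succ]
    fun_prop

end Chain

/-! ### Regularity of the drift and solvability of the heat equation -/

section Drift

variable {N : ℕ} {f : ℝ → ℝ → ℝ} {TL TR : ℝ}

lemma contDiffOn_drift (hf : IsRateFunction f) (hTL : 0 < TL) (hTR : 0 < TR) :
    ContDiffOn ℝ 1 (drift f TL TR) {E : Fin N → ℝ | ∀ i, 0 < E i} := by
  have key : ∀ j k : Fin (N + 2), ContDiffOn ℝ 1
      (fun E : Fin N → ℝ => f (chain TL TR E j) (chain TL TR E k)) {E | ∀ i, 0 < E i} := by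
    intro j k
    refine hf.contDiffOn.comp (f := fun E : Fin N → ℝ => (chain TL TR E j, chain TL TR E k))
      ((contDiff_chain TL TR j).prodMk (contDiff_chain TL TR k)).contDiffOn ?_
    intro E hE
    exact ⟨chain_pos hTL hTR hE j, chain_pos hTL hTR hE k⟩
  rw [contDiffOn_pi]
  intro i
  have h1 := key i.castSucc.castSucc i.castSucc.succ
  have h2 := key i.castSucc.succ i.succ.succ
  simp only [chain_castSucc_succ] at h1 h2
  have hi : ContDiff ℝ 1 (fun E : Fin N → ℝ => E i) := contDiff_apply ℝ ℝ i
  exact ((contDiffOn_const.mul h1).mul ((contDiff_chain TL TR _).sub hi).contDiffOn).add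
    ((contDiffOn_const.mul h2).mul ((contDiff_chain TL TR _).sub hi).contDiffOn)

/-- The energy profiles with all entries in `[a, b]`. -/
def box (N : ℕ) (a b : ℝ) : Set (Fin N → ℝ) := Set.Icc (fun _ => a) (fun _ => b)

lemma mem_box {a b : ℝ} {E : Fin N → ℝ} : E ∈ box N a b ↔ ∀ i, a ≤ E i ∧ E i ≤ b := by
  simp only [box, Set.mem_Icc, Pi.le_def, forall_and]

lemma contDiffOn_drift_box (hf : IsRateFunction f) (hTL : 0 < TL) (hTR : 0 < TR) {a b : ℝ}
    (ha : 0 < a) : ContDiffOn ℝ 1 (drift f TL TR) (box N a b) :=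
  (contDiffOn_drift hf hTL hTR).mono fun _ hE i => ha.trans_le (mem_box.1 hE i).1

/-- For `a > 0` the box is a compact convex subset of the region where the drift is C¹; near the
boundary of the quadrant no such constant need exist. -/
lemma exists_lipschitz_drift (hf : IsRateFunction f) (hTL : 0 < TL) (hTR : 0 < TR) {a b : ℝ}
    (ha : 0 < a) : ∃ L : NNReal, LipschitzOnWith L (drift f TL TR) (box N a b) :=
  (contDiffOn_drift_box hf hTL hTR ha).exists_lipschitzOnWith one_ne_zero
    (convex_Icc _ _) isCompact_Icc

lemma exists_bound_drift (hf : IsRateFunction f) (hTL : 0 < TL) (hTR : 0 < TR) {a b : ℝ}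
    (ha : 0 < a) : ∃ C : NNReal, ∀ E ∈ box N a b, ‖drift f TL TR E‖ ≤ C := by
  obtain ⟨C, hC⟩ := IsCompact.exists_bound_of_continuousOn (s := box N a b) isCompact_Icc
    (contDiffOn_drift_box hf hTL hTR ha).continuousOn
  exact ⟨C.toNNReal, fun E hE => (hC E hE).trans (Real.le_coe_toNNReal C)⟩

/-- A function whose derivative is nonpositive wherever it exceeds `c` stays below `c`. -/
lemma le_of_deriv_nonpos_of_gt {g g' : ℝ → ℝ} {T c : ℝ}
    (hg : ∀ t ∈ Set.Icc 0 T, HasDerivWithinAt g (g' t) (Set.Icc 0 T) t) (h0 : g 0 ≤ c)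
    (h : ∀ t ∈ Set.Icc 0 T, c < g t → g' t ≤ 0) : ∀ t ∈ Set.Icc 0 T, g t ≤ c := by
  intro t ht
  refine le_of_forall_pos_le_add fun ε hε => ?_
  have hT : 0 < 1 + T := by linarith [ht.1.trans ht.2]
  set δ := ε / (1 + T) with hδ
  have hδ0 : 0 < δ := by positivity
  -- The barrier `c + δ (1 + s)` rises with slope `δ > 0` and stays strictly above `c`, so wherever
  -- `g` touches it the hypothesis gives `g' ≤ 0 < δ`.
  have key := image_le_of_deriv_right_lt_deriv_boundary' (f := g) (f' := g') (a := 0) (b := T)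
    (B := fun s => c + δ * (1 + s)) (B' := fun _ => δ)
    (fun s hs => (hg s hs).continuousWithinAt)
    (fun s hs => (hg s ⟨hs.1, hs.2.le⟩).mono_of_mem_nhdsWithin
      (mem_of_superset (Icc_mem_nhdsGE hs.2) (Set.Icc_subset_Icc_left hs.1)))
    (by simp only [add_zero, mul_one]; linarith) (by fun_prop)
    (fun s _ => by
      have := (((hasDerivAt_id s).const_add 1).const_mul δ).const_add c
      simpa using this.hasDerivWithinAt)
    (fun s hs heq => by
      refine (h s ⟨hs.1, hs.2.le⟩ ?_).trans_lt hδ0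
      rw [heq]
      have : 0 < δ * (1 + s) := mul_pos hδ0 (by linarith [hs.1])
      linarith) ht
  refine key.trans ?_
  have : δ * (1 + t) ≤ δ * (1 + T) := by gcongr; exact ht.2
  have h2 : δ * (1 + T) = ε := by rw [hδ]; field_simp
  linarith

/-- The coordinatewise projection onto `box N a b`. -/
def clamp (a b : ℝ) (E : Fin N → ℝ) : Fin N → ℝ := fun i => max a (min b (E i))

lemma clamp_mem {a b : ℝ} (hab : a ≤ b) (E : Fin N → ℝ) : clamp a b E ∈ box N a b :=
  mem_box.2 fun _ => ⟨le_max_left _ _, max_le hab (min_le_left _ _)⟩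

lemma lipschitzWith_clamp (a b : ℝ) : LipschitzWith 1 (clamp (N := N) a b) := by
  refine LipschitzWith.of_dist_le_mul fun x y => ?_
  rw [dist_pi_le_iff (by positivity)]
  intro i
  exact (((LipschitzWith.eval (α := fun _ : Fin N => ℝ) i).const_min b).const_max a).dist_le_mul x y

/-- The heat equation has a global solution, which stays in any box that contains the initial
profile and the two bath temperatures. -/
theorem exists_isSolution (hf : IsRateFunction f) (hTL : 0 < TL) (hTR : 0 < TR)
    {E₀ : Fin N → ℝ} (hE₀ : ∀ i, 0 < E₀ i) {T : ℝ} (hT : 0 < T) :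
    ∃ θ : ℝ → Fin N → ℝ, IsSolution f TL TR E₀ T θ := by
  obtain ⟨a, b, ha, haL, haR, haE, hLb, hRb, hEb⟩ : ∃ a b : ℝ, 0 < a ∧ a ≤ TL ∧ a ≤ TR ∧
      (∀ i, a ≤ E₀ i) ∧ TL ≤ b ∧ TR ≤ b ∧ ∀ i, E₀ i ≤ b := by
    obtain ⟨i, -, hi⟩ := Finset.exists_min_image Finset.univ (chain TL TR E₀) ⟨0, by simp⟩
    obtain ⟨k, -, hk⟩ := Finset.exists_max_image Finset.univ (chain TL TR E₀) ⟨0, by simp⟩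
    refine ⟨chain TL TR E₀ i, chain TL TR E₀ k, chain_pos hTL hTR hE₀ i, ?_, ?_, ?_, ?_, ?_, ?_⟩
    · simpa using hi 0
    · simpa using hi (Fin.last _)
    · exact fun j => by simpa using hi j.castSucc.succ
    · simpa using hk 0
    · simpa using hk (Fin.last _)
    · exact fun j => by simpa using hk j.castSucc.succ
  have hab : a ≤ b := haL.trans hLb
  obtain ⟨L, hL⟩ := exists_lipschitz_drift (N := N) (b := b) hf hTL hTR ha
  obtain ⟨C, hC⟩ := exists_bound_drift (N := N) (b := b) hf hTL hTR ha
  have hlip : LipschitzWith (L * 1) (fun E : Fin N → ℝ => drift f TL TR (clamp a b E)) := by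
    rw [← lipschitzOnWith_univ]
    exact hL.comp (lipschitzWith_clamp a b).lipschitzOnWith fun E _ => clamp_mem hab E
  -- The truncated field is globally Lipschitz and bounded by `C`, so the ball of radius `C T` is
  -- large enough for a solution on all of `[0, T]`.
  have hPL : IsPicardLindelof (fun _ : ℝ => fun E : Fin N → ℝ => drift f TL TR (clamp a b E))
      (⟨0, le_rfl, hT.le⟩ : Set.Icc 0 T) E₀ (C * T.toNNReal) 0 C (L * 1) :=
    { lipschitzOnWith := fun _ _ => hlip.lipschitzOnWith
      continuousOn := fun _ _ => continuousOn_const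
      norm_le := fun _ _ E _ => hC _ (clamp_mem hab E)
      mul_max_le := by simp [hT.le] }
  obtain ⟨θ, hθ0, hθ⟩ := hPL.exists_eq_forall_mem_Icc_hasDerivWithinAt
    (Metric.mem_closedBall_self le_rfl)
  have hcoord := fun t ht => hasDerivWithinAt_pi.1 (hθ t ht)
  have hfpos : ∀ x y, a ≤ x → a ≤ y → 0 < f x y := fun x y hx hy =>
    hf.pos x y (ha.trans_le hx) (ha.trans_le hy)
  have hcl : ∀ t i, a ≤ clamp a b (θ t) i ∧ clamp a b (θ t) i ≤ b := fun t =>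
    mem_box.1 (clamp_mem hab (θ t))
  have hch : ∀ t j, a ≤ chain TL TR (clamp a b (θ t)) j := fun t =>
    le_chain haL haR fun i => (hcl t i).1
  have hch' : ∀ t j, chain TL TR (clamp a b (θ t)) j ≤ b := fun t =>
    chain_le hLb hRb fun i => (hcl t i).2
  have hub : ∀ i, ∀ t ∈ Set.Icc 0 T, θ t i ≤ b := by
    intro i
    refine le_of_deriv_nonpos_of_gt (fun t ht => hcoord t ht i) (by rw [hθ0]; exact hEb i) ?_
    intro t _ hgt
    -- Maximum principle: truncation lowers the coordinate exactly to `b`, and its neighbours are at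
    -- most `b`, so both flux terms are nonpositive. The lower bound is symmetric.
    have hc : clamp a b (θ t) i = b := by simp [clamp, hgt.le, hab]
    simp only [drift, hc]
    have h1 := hfpos _ b (hch t i.castSucc.castSucc) hab
    have h2 := hfpos b _ hab (hch t i.succ.succ)
    have h3 := hch' t i.castSucc.castSucc
    have h4 := hch' t i.succ.succ
    have h5 := mul_nonneg h1.le (sub_nonneg.2 h3)
    have h6 := mul_nonneg h2.le (sub_nonneg.2 h4)
    linarith
  have hlb : ∀ i, ∀ t ∈ Set.Icc 0 T, a ≤ θ t i := by
    intro i t ht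
    refine neg_le_neg_iff.1 (le_of_deriv_nonpos_of_gt (g := fun t => -θ t i)
      (fun t ht => (hcoord t ht i).neg) (by rw [hθ0]; exact neg_le_neg (haE i)) ?_ t ht)
    intro t _ hgt
    have hc : clamp a b (θ t) i = a := by
      have : θ t i ≤ a := by linarith
      simp [clamp, this]
    simp only [drift, hc]
    have h1 := hfpos _ a (hch t i.castSucc.castSucc) le_rfl
    have h2 := hfpos a _ le_rfl (hch t i.succ.succ)
    have h3 := hch t i.castSucc.castSucc
    have h4 := hch t i.succ.succ
    have h5 := mul_nonneg h1.le (sub_nonneg.2 h3)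
    have h6 := mul_nonneg h2.le (sub_nonneg.2 h4)
    linarith
  refine ⟨θ, hθ0, fun t ht i => ha.trans_le (hlb i t ht), fun t ht => ?_⟩
  have hc : clamp a b (θ t) = θ t := by
    funext i
    simp [clamp, hub i t ht, hlb i t ht]
  simpa only [hc] using hθ t ht

end Drift

/-! ### Noisy Euler schemes and the discrete Gronwall argument -/

section Tracking

variable {V : Type*} [NormedAddCommGroup V] [NormedSpace ℝ V]

lemma norm_sub_le_of_solution {F : V → V} {G : Set V} {θ : ℝ → V} {T C : ℝ}
    (hθ : ∀ t ∈ Set.Icc 0 T, HasDerivWithinAt θ (F (θ t)) (Set.Icc 0 T) t)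
    (hG : ∀ t ∈ Set.Icc 0 T, θ t ∈ G) (hC : ∀ x ∈ G, ‖F x‖ ≤ C)
    {s t : ℝ} (hs : 0 ≤ s) (hst : s ≤ t) (ht : t ≤ T) : ‖θ t - θ s‖ ≤ C * (t - s) := by
  have := Convex.norm_image_sub_le_of_norm_hasDerivWithin_le (C := C) hθ
    (fun r hr => hC _ (hG r hr)) (convex_Icc 0 T) ⟨hs, hst.trans ht⟩ ⟨hs.trans hst, ht⟩
  rwa [Real.norm_of_nonneg (sub_nonneg.2 hst)] at this

/-- Mean value inequality for `θ r - r • F x`: its derivative `F (θ r) - F x` is small because `θ`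
moves by at most `C h` during the step and starts at distance `‖x - θ s‖` from `x`. -/
lemma norm_solution_step_le {F : V → V} {G : Set V} {θ : ℝ → V} {T C h : ℝ} {L : NNReal}
    (hθ : ∀ t ∈ Set.Icc 0 T, HasDerivWithinAt θ (F (θ t)) (Set.Icc 0 T) t)
    (hG : ∀ t ∈ Set.Icc 0 T, θ t ∈ G) (hC : ∀ x ∈ G, ‖F x‖ ≤ C) (hC0 : 0 ≤ C)
    (hL : LipschitzOnWith L F G) {x : V} (hx : x ∈ G)
    {s t : ℝ} (hs : 0 ≤ s) (hst : s ≤ t) (ht : t ≤ T) (hh : t - s ≤ h) :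
    ‖θ t - θ s - (t - s) • F x‖ ≤ L * (‖x - θ s‖ + C * h) * (t - s) := by
  have hder : ∀ r ∈ Set.Icc s t,
      HasDerivWithinAt (fun r => θ r - r • F x) (F (θ r) - F x) (Set.Icc s t) r := by
    intro r hr
    have h1 := (hθ r ⟨hs.trans hr.1, hr.2.trans ht⟩).mono (Set.Icc_subset_Icc hs ht)
    have h2 := ((hasDerivAt_id r).smul_const (F x)).hasDerivWithinAt (s := Set.Icc s t)
    exact (h1.sub h2).congr_deriv (by simp)
  have hbd : ∀ r ∈ Set.Icc s t, ‖F (θ r) - F x‖ ≤ L * (‖x - θ s‖ + C * h) := by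
    intro r hr
    have hr' : r ∈ Set.Icc 0 T := ⟨hs.trans hr.1, hr.2.trans ht⟩
    have h1 := hL.dist_le_mul _ (hG r hr') _ hx
    rw [dist_eq_norm, dist_eq_norm] at h1
    refine h1.trans (mul_le_mul_of_nonneg_left ?_ L.2)
    have h2 := norm_sub_le_of_solution hθ hG hC hs hr.1 (hr.2.trans ht)
    have h3 : C * (r - s) ≤ C * h := mul_le_mul_of_nonneg_left (by linarith [hr.2]) hC0
    calc ‖θ r - x‖ = ‖(θ r - θ s) - (x - θ s)‖ := by congr 1; abel
      _ ≤ ‖θ r - θ s‖ + ‖x - θ s‖ := norm_sub_le _ _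
      _ ≤ _ := by linarith
  have := Convex.norm_image_sub_le_of_norm_hasDerivWithin_le hder hbd (convex_Icc s t)
    ⟨le_rfl, hst⟩ ⟨hst, le_rfl⟩
  rw [Real.norm_of_nonneg (sub_nonneg.2 hst)] at this
  convert this using 2
  rw [sub_smul]
  abel

/-- A noisy Euler scheme with small noise `S` and small steps stays close to the solution of the
differential equation, as long as the scheme has only been controlled inside a neighbourhood `G` of
the solution. -/
theorem euler_scheme_tracking {F : V → V} {G : Set V} {θ : ℝ → V} {T C h η δ : ℝ} {L : NNReal}
    (hθ : ∀ t ∈ Set.Icc 0 T, HasDerivWithinAt θ (F (θ t)) (Set.Icc 0 T) t)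
    (hδ : 0 ≤ δ) (hG : ∀ t ∈ Set.Icc 0 T, ∀ x, ‖x - θ t‖ ≤ δ → x ∈ G)
    (hC : ∀ x ∈ G, ‖F x‖ ≤ C) (hC0 : 0 ≤ C) (hL : LipschitzOnWith L F G)
    {X S : ℕ → V} {τ : ℕ → ℝ} (hτ : Monotone τ) (hτ0 : τ 0 = 0) (hX0 : X 0 = θ 0) (hS0 : S 0 = 0)
    {n₀ : ℕ} (hh0 : 0 ≤ h)
    (hS : ∀ m, X m ∈ G → S (m + 1) - S m = X (m + 1) - X m - (τ (m + 1) - τ m) • F (X m))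
    (hh : ∀ m < n₀, X m ∈ G → τ (m + 1) - τ m ≤ h) (hη : ∀ n ≤ n₀, ‖S n‖ ≤ η)
    (hsmall : (η + C * h) * Real.exp (L * T) ≤ δ) :
    ∀ n ≤ n₀, τ n ≤ T → X n ∈ G ∧ ‖X n - θ (τ n)‖ ≤ (η + C * h) * Real.exp (L * T) := by
  have hη0 : 0 ≤ η := (norm_nonneg _).trans (hη 0 (Nat.zero_le _))
  have hτnn : ∀ n, 0 ≤ τ n := fun n => hτ0 ▸ hτ (Nat.zero_le n)
  have hGθ : ∀ t ∈ Set.Icc 0 T, θ t ∈ G := fun t ht => hG t ht _ (by simpa using hδ)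
  have hCh : 0 ≤ C * h := mul_nonneg hC0 hh0
  -- Bootstrap: the Gronwall bound at step `n` already puts `X n` in `G`, which unlocks the
  -- hypotheses on the next step.
  have key : ∀ n ≤ n₀, τ n ≤ T →
      ‖X n - S n - θ (τ n)‖ + (η + C * h) ≤ (η + C * h) * Real.exp (L * τ n) → X n ∈ G ∧
        ‖X n - θ (τ n)‖ ≤ ‖X n - S n - θ (τ n)‖ + η ∧
        ‖X n - θ (τ n)‖ ≤ (η + C * h) * Real.exp (L * T) := by
    intro n hn hnT hv
    have h1 : ‖X n - θ (τ n)‖ ≤ ‖X n - S n - θ (τ n)‖ + η :=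
      calc ‖X n - θ (τ n)‖ = ‖(X n - S n - θ (τ n)) + S n‖ := by congr 1; abel
        _ ≤ _ := (norm_add_le _ _).trans (add_le_add_right (hη n hn) _)
    have h2 : (η + C * h) * Real.exp (L * τ n) ≤ (η + C * h) * Real.exp (L * T) := by
      gcongr
    have h3 : ‖X n - θ (τ n)‖ ≤ (η + C * h) * Real.exp (L * T) := by linarith
    exact ⟨hG _ ⟨hτnn n, hnT⟩ _ (h3.trans hsmall), h1, h3⟩
  -- The induction runs on `X - S`, which makes pure Euler steps; only the partial sums `S` are
  -- small, through cancellation. Adding `η + C h` to both sides makes the recursion multiplicative,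
  -- with factor `1 + L Δ ≤ exp (L Δ)`.
  suffices ∀ n ≤ n₀, τ n ≤ T →
      ‖X n - S n - θ (τ n)‖ + (η + C * h) ≤ (η + C * h) * Real.exp (L * τ n) from
    fun n hn hnT => ⟨(key n hn hnT (this n hn hnT)).1, (key n hn hnT (this n hn hnT)).2.2⟩
  intro n
  induction n with
  | zero => intro _ _; simp [hτ0, hX0, hS0]
  | succ n ih =>
    intro hn hnT
    have hle : τ n ≤ τ (n + 1) := hτ n.le_succ
    have ih' := ih (by omega) (hle.trans hnT)
    obtain ⟨hXG, hd, -⟩ := key n (by omega) (hle.trans hnT) ih'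
    have hstep := norm_solution_step_le hθ hGθ hC hC0 hL hXG (hτnn n) hle hnT (hh n hn hXG)
    set Δ := τ (n + 1) - τ n with hΔ
    have hΔ0 : 0 ≤ Δ := sub_nonneg.2 hle
    have h1 : ‖X (n + 1) - S (n + 1) - θ (τ (n + 1))‖ ≤
        ‖X n - S n - θ (τ n)‖ + L * (‖X n - θ (τ n)‖ + C * h) * Δ := by
      have : X (n + 1) - S (n + 1) - θ (τ (n + 1)) = (X n - S n - θ (τ n)) -
          (θ (τ (n + 1)) - θ (τ n) - Δ • F (X n)) := by
        have e := hS n hXG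
        have : S (n + 1) = S n + (X (n + 1) - X n - Δ • F (X n)) := by rw [← e]; abel
        rw [this]; abel
      rw [this]
      exact (norm_sub_le _ _).trans (add_le_add_right hstep _)
    have hL0 : (0 : ℝ) ≤ L * Δ := mul_nonneg L.2 hΔ0
    have h2 : ‖X (n + 1) - S (n + 1) - θ (τ (n + 1))‖ + (η + C * h) ≤
        (‖X n - S n - θ (τ n)‖ + (η + C * h)) * (L * Δ + 1) := by
      have : L * (‖X n - θ (τ n)‖ + C * h) * Δ ≤
          (L * Δ) * (‖X n - S n - θ (τ n)‖ + (η + C * h)) := by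
        calc L * (‖X n - θ (τ n)‖ + C * h) * Δ = (L * Δ) * (‖X n - θ (τ n)‖ + C * h) := by ring
          _ ≤ _ := mul_le_mul_of_nonneg_left (by linarith) hL0
      linarith
    refine h2.trans ((mul_le_mul ih' (Real.add_one_le_exp _) (by positivity)
      (by positivity)).trans_eq ?_)
    rw [mul_assoc, ← Real.exp_add]
    congr 2
    rw [hΔ]; ring

end Tracking

/-! ### Sample paths: positivity, rate bounds, tracking of the solution -/

section Paths

variable {N : ℕ} {f : ℝ → ℝ → ℝ} {TL TR : ℝ}

lemma neg_mul_log_one_sub_pos {c u : ℝ} (hc : 0 < c) (hu : u ∈ Set.Ioo (0 : ℝ) 1) :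
    0 < -c * Real.log (1 - u) := by
  have : Real.log (1 - u) < 0 := Real.log_neg (by linarith [hu.2]) (by linarith [hu.1])
  nlinarith

/-- Even if both adjacent clocks took energy from the cell, the fraction lost would be at most `p B₂
+ (1 - p) B₁ < 1`, so it is not needed here that a single clock rings. -/
lemma increment_pos (hTL : 0 < TL) (hTR : 0 < TR) {E : Fin N → ℝ} (hE : ∀ i, 0 < E i)
    {w : Source → ℝ} (hw : ∀ s, w s ∈ Set.Ioo (0 : ℝ) 1) (i : Fin N) :
    0 < E i + increment f TL TR E w i := by
  have hch := chain_pos (neg_mul_log_one_sub_pos hTL (hw .bath))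
    (neg_mul_log_one_sub_pos hTR (hw .bath)) hE
  have hp := hw .split
  have hp' : 0 < 1 - w .split := sub_pos.2 hp.2
  have h1 : -(w .split * w .beta₂ * E i) ≤ flux TL TR E w i.castSucc := by
    simp only [flux, chain_castSucc_succ]
    have := mul_nonneg (mul_nonneg hp'.le (hw .beta₁).1.le) (hch i.castSucc.castSucc).le
    linarith
  have h2 : flux TL TR E w i.succ ≤ (1 - w .split) * w .beta₁ * E i := by
    simp only [flux, chain_succ_castSucc]
    have := mul_nonneg (mul_nonneg hp.1.le (hw .beta₂).1.le) (hch i.succ.succ).le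
    linarith
  have h3 : 0 < w .split * w .beta₂ * E i := mul_pos (mul_pos hp.1 (hw .beta₂).1) (hE i)
  have h4 : 0 < (1 - w .split) * w .beta₁ * E i := mul_pos (mul_pos hp' (hw .beta₁).1) (hE i)
  have h5 : w .split * w .beta₂ + (1 - w .split) * w .beta₁ < 1 := by
    have := mul_lt_mul_of_pos_left (hw .beta₂).2 hp.1
    have := mul_lt_mul_of_pos_left (hw .beta₁).2 hp'
    linarith
  have h6 := mul_lt_mul_of_pos_right h5 (hE i)
  simp only [increment]
  split_ifs <;> linarith

lemma jumpChain_pos (hTL : 0 < TL) (hTR : 0 < TR) {E₀ : Fin N → ℝ} (hE₀ : ∀ i, 0 < E₀ i)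
    {w : ℕ → Source → ℝ} (hw : ∀ n s, w n s ∈ Set.Ioo (0 : ℝ) 1) (n : ℕ) :
    ∀ i, 0 < jumpChain f TL TR E₀ w n i := by
  induction n with
  | zero => exact hE₀
  | succ n ih => exact fun i => increment_pos hTL hTR ih (hw n) i

lemma clockRate_pos (hf : IsRateFunction f) (hTL : 0 < TL) (hTR : 0 < TR) {E : Fin N → ℝ}
    (hE : ∀ i, 0 < E i) (k : Fin (N + 1)) : 0 < clockRate f TL TR E k :=
  hf.pos _ _ (chain_pos hTL hTR hE _) (chain_pos hTL hTR hE _)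

lemma totalRate_pos (hf : IsRateFunction f) (hTL : 0 < TL) (hTR : 0 < TR) {E : Fin N → ℝ}
    (hE : ∀ i, 0 < E i) : 0 < totalRate f TL TR E :=
  Finset.sum_pos (fun k _ => clockRate_pos hf hTL hTR hE k) Finset.univ_nonempty

/-- Monotonicity bounds a single clock from below, and the others are positive. This keeps waiting
times of order at most 1/M in the box. -/
lemma le_totalRate (hf : IsRateFunction f) {a : ℝ} (ha : 0 < a) (hTL : a ≤ TL) (hTR : a ≤ TR)
    {E : Fin N → ℝ} (hE : ∀ i, a ≤ E i) : f a a ≤ totalRate f TL TR E := by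
  have hE' : ∀ i, 0 < E i := fun i => ha.trans_le (hE i)
  refine (hf.mono a _ a _ ha ha (le_chain hTL hTR hE _) (le_chain hTL hTR hE _)).trans
    (Finset.single_le_sum (f := clockRate f TL TR E) (fun k _ =>
      (clockRate_pos hf (ha.trans_le hTL) (ha.trans_le hTR) hE' k).le) (Finset.mem_univ 0))

lemma totalRate_le {K : ℝ} (hK : ∀ x y, 0 < x → 0 < y → f x y < K) (hTL : 0 < TL) (hTR : 0 < TR)
    {E : Fin N → ℝ} (hE : ∀ i, 0 < E i) : totalRate f TL TR E ≤ (N + 1) * K := by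
  have := Finset.sum_le_card_nsmul Finset.univ (clockRate f TL TR E) K fun k _ =>
    (hK _ _ (chain_pos hTL hTR hE k.castSucc) (chain_pos hTL hTR hE k.succ)).le
  simpa [totalRate] using this

/-- The standard exponential variable which drives the waiting time of a step. -/
def holdExp (w : Source → ℝ) : ℝ := -Real.log (1 - w .hold)

lemma holdExp_pos {w : Source → ℝ} (hw : ∀ s, w s ∈ Set.Ioo (0 : ℝ) 1) : 0 < holdExp w := by
  have := neg_mul_log_one_sub_pos one_pos (hw .hold)
  simpa [holdExp] using this

open Classical in
/-- The deviation of the increment of the energy of cell `i` from the drift, while the profile is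
in `box N a b`. -/
def energyNoise (f : ℝ → ℝ → ℝ) (TL TR a b : ℝ) (M : ℕ) (i : Fin N) (E : Fin N → ℝ)
    (w : Source → ℝ) : ℝ :=
  if E ∈ box N a b then
    increment f TL TR E w i - drift f TL TR E i * (holdExp w / (M * totalRate f TL TR E))
  else 0

open Classical in
/-- The deviation of the waiting time, on the fast scale, from its mean, while the profile is in
`box N a b`. -/
def timeNoise (f : ℝ → ℝ → ℝ) (TL TR a b : ℝ) (M : ℕ) (E : Fin N → ℝ) (w : Source → ℝ) : ℝ :=
  if E ∈ box N a b then (holdExp w - 1) / (M * totalRate f TL TR E) else 0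

/-- By compactness the entries of the chain, bath temperatures included, have a positive minimum
over `[0, T]`; half of it serves as both the lower edge of the box and the radius of the tube. -/
lemma IsSolution.exists_tube {E₀ : Fin N → ℝ} {T : ℝ} {θ : ℝ → Fin N → ℝ} (hT : 0 < T)
    (hTL : 0 < TL) (hTR : 0 < TR) (hθ : IsSolution f TL TR E₀ T θ) :
    ∃ a b δ : ℝ, 0 < a ∧ a ≤ TL ∧ a ≤ TR ∧ 0 < δ ∧
      ∀ t ∈ Set.Icc 0 T, ∀ x, ‖x - θ t‖ ≤ δ → x ∈ box N a b := by
  have hcont : ContinuousOn θ (Set.Icc 0 T) := fun t ht => (hθ.deriv t ht).continuousWithinAt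
  obtain ⟨B, hB⟩ := isCompact_Icc.exists_bound_of_continuousOn hcont
  have hmin : ∀ j : Fin (N + 2), ∃ c, 0 < c ∧ ∀ t ∈ Set.Icc 0 T, c ≤ chain TL TR (θ t) j := by
    intro j
    obtain ⟨t, ht, hmin⟩ := isCompact_Icc.exists_isMinOn (Set.nonempty_Icc.2 hT.le)
      ((contDiff_chain TL TR j).continuous.comp_continuousOn hcont)
    exact ⟨chain TL TR (θ t) j, chain_pos hTL hTR (hθ.pos t ht) j, fun s hs => hmin hs⟩
  choose c hc0 hc using hmin
  obtain ⟨j, -, hj⟩ := Finset.exists_min_image Finset.univ c ⟨0, by simp⟩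
  have hj' : ∀ t ∈ Set.Icc 0 T, ∀ k, c j ≤ chain TL TR (θ t) k := fun t ht k =>
    (hj k (Finset.mem_univ k)).trans (hc k t ht)
  have h0 : (0 : ℝ) ∈ Set.Icc 0 T := ⟨le_rfl, hT.le⟩
  have hjpos := hc0 j
  refine ⟨c j / 2, B + c j / 2, c j / 2, by linarith, ?_, ?_, by linarith, ?_⟩
  · have := hj' 0 h0 0
    rw [chain_zero] at this; linarith
  · have := hj' 0 h0 (Fin.last _)
    rw [chain_last] at this; linarith
  · intro t ht x hx
    rw [mem_box]
    intro i
    have h1 := (norm_le_pi_norm (x - θ t) i).trans hx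
    have h2 := (norm_le_pi_norm (θ t) i).trans (hB t ht)
    have h3 := hj' t ht i.castSucc.succ
    rw [chain_castSucc_succ] at h3
    rw [Real.norm_eq_abs, abs_le] at h1 h2
    simp only [Pi.sub_apply] at h1
    constructor <;> linarith

/-- On the event that the accumulated noise is small, the fast process is close to the solution of
the heat equation. -/
theorem IsSolution.exists_tracking (hf : IsRateFunction f) (hTL : 0 < TL) (hTR : 0 < TR)
    {E₀ : Fin N → ℝ} (hE₀ : ∀ i, 0 < E₀ i) {T : ℝ} (hT : 0 < T) {θ : ℝ → Fin N → ℝ}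
    (hθ : IsSolution f TL TR E₀ T θ) :
    ∃ a b : ℝ, 0 < a ∧ a ≤ TL ∧ a ≤ TR ∧ ∃ c : ℕ, ∀ ε > 0, ∃ η > 0, ∃ M₀ : ℕ, ∀ M ≥ M₀,
      ∀ w : ℕ → Source → ℝ, (∀ n s, w n s ∈ Set.Ioo (0 : ℝ) 1) →
      (∀ i, ∀ n ≤ c * M, |∑ m ∈ Finset.range n,
        energyNoise f TL TR a b M i (jumpChain f TL TR E₀ w m) (w m)| ≤ η) →
      (∀ n ≤ c * M, |∑ m ∈ Finset.range n,
        timeNoise f TL TR a b M (jumpChain f TL TR E₀ w m) (w m)| ≤ η) →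
      ∀ t ∈ Set.Icc 0 T, dist (fastProcess f TL TR E₀ M w t) (θ t) ≤ ε := by
  obtain ⟨a, b, δ, ha, haL, haR, hδ, hG⟩ := hθ.exists_tube hT hTL hTR
  obtain ⟨L, hL⟩ := exists_lipschitz_drift (N := N) (b := b) hf hTL hTR ha
  obtain ⟨C, hC⟩ := exists_bound_drift (N := N) (b := b) hf hTL hTR ha
  obtain ⟨K, hK⟩ := hf.bounded
  have hK0 : 0 < K := (hf.pos 1 1 one_pos one_pos).trans (hK 1 1 one_pos one_pos)
  have hr := hf.pos a a ha ha
  set r := f a a with hr_def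
  have hR1 : 0 < (N + 1) * K := by positivity
  -- The total rate is at most `(N + 1) K`, so this many steps per unit of `M` have mean waiting
  -- times adding up to at least `T + 2`, with room for a time noise of at most 1.
  refine ⟨a, b, ha, haL, haR, ⌈(N + 1) * K * (T + 2)⌉₊, fun ε hε => ?_⟩
  set c := ⌈(N + 1) * K * (T + 2)⌉₊ with hc
  -- `η A` dominates the Gronwall error for steps of length at most `3 η` plus the motion of `θ`
  -- within one step. It must be below `δ` to stay in the tube and below `ε` for the conclusion.
  set A : ℝ := (1 + C * 3) * (Real.exp (L * T) + 1) with hA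
  have hA0 : 0 < A := by positivity
  obtain ⟨η, hη0, hη1, hηδ⟩ : ∃ η : ℝ, 0 < η ∧ η ≤ 1 ∧ η * A ≤ min δ ε := by
    refine ⟨min 1 (min δ ε / A), lt_min one_pos (by positivity), min_le_left _ _, ?_⟩
    calc min 1 (min δ ε / A) * A ≤ min δ ε / A * A := by gcongr; exact min_le_right _ _
      _ = min δ ε := by field_simp
  -- This size of `M` makes every mean waiting time in the box at most `1 / (M r) ≤ η`.
  refine ⟨η, hη0, ⌈1 / (r * η)⌉₊ + 1, fun M hM w hw hS hS' => ?_⟩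
  have hM0 : 0 < (M : ℝ) := by exact_mod_cast (by omega : 0 < M)
  have hMr : 1 / (M * r) ≤ η := by
    have h1 : 1 / (r * η) ≤ M := (Nat.le_ceil _).trans (by exact_mod_cast (by omega))
    rw [div_le_iff₀ (by positivity)] at h1 ⊢
    linarith
  set X := jumpChain f TL TR E₀ w with hX
  set τ : ℕ → ℝ := fun n => jumpTime f TL TR E₀ w n / M with hτ
  set S : ℕ → Fin N → ℝ := fun n i => ∑ m ∈ Finset.range n,
    energyNoise f TL TR a b M i (X m) (w m) with hSdef
  have hXpos : ∀ n i, 0 < X n i := jumpChain_pos hTL hTR hE₀ hw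
  have hRpos : ∀ n, 0 < totalRate f TL TR (X n) := fun n => totalRate_pos hf hTL hTR (hXpos n)
  have hΔ : ∀ n, τ (n + 1) - τ n = holdExp (w n) / (M * totalRate f TL TR (X n)) := by
    intro n
    have := (hRpos n).ne'
    simp only [hτ, jumpTime, holdExp, ← hX]
    field_simp
    ring
  have hΔpos : ∀ n, 0 < τ (n + 1) - τ n := fun n => by
    rw [hΔ]; exact div_pos (holdExp_pos (hw n)) (mul_pos hM0 (hRpos n))
  have hmono : StrictMono τ := strictMono_nat_of_lt_succ fun n => sub_pos.1 (hΔpos n)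
  have hτ0 : τ 0 = 0 := by simp [hτ, jumpTime]
  have htime : ∀ n, X n ∈ box N a b → timeNoise f TL TR a b M (X n) (w n) =
      τ (n + 1) - τ n - 1 / (M * totalRate f TL TR (X n)) := by
    intro n hn
    rw [timeNoise, if_pos hn, hΔ, sub_div]
  -- One time noise term is a difference of two partial sums, hence at most `2 η`; the mean
  -- contributes another `η`.
  have hstep : ∀ m < c * M, X m ∈ box N a b → τ (m + 1) - τ m ≤ 3 * η := by
    intro m hm hXm
    have h1 := hS' (m + 1) hm
    have h2 := hS' m hm.le
    rw [Finset.sum_range_succ, htime m hXm] at h1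
    rw [abs_le] at h1 h2
    have h3 : 1 / (M * totalRate f TL TR (X m)) ≤ 1 / (M * r) := by
      have := le_totalRate hf ha haL haR fun i => (mem_box.1 hXm i).1
      gcongr
    linarith
  have hηA : (η + C * (3 * η)) * Real.exp (L * T) + C * (3 * η) ≤ min δ ε := by
    refine le_trans ?_ hηδ
    have : 0 ≤ η := hη0.le
    rw [hA]
    nlinarith
  have hC3 : 0 ≤ C * (3 * η) := by positivity
  have htrack := euler_scheme_tracking (S := S) (τ := τ) (X := X) (n₀ := c * M) hθ.deriv hδ.le hG hC
    C.2 hL hmono.monotone hτ0 hθ.initial.symm (by funext i; simp [hSdef])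
    (by positivity : 0 ≤ 3 * η)
    (fun m hm => by
      funext i
      simp only [hSdef, Pi.sub_apply, Finset.sum_range_succ, Pi.smul_apply, smul_eq_mul]
      rw [energyNoise, if_pos hm, hΔ, hX]
      simp only [jumpChain, Pi.add_apply]
      ring)
    hstep
    (fun n hn => (pi_norm_le_iff_of_nonneg hη0.le).2 fun i => hS i n hn)
    (by linarith [min_le_left δ ε])
  -- Otherwise the chain would stay in the box up to step `c M`, so the time noise would be the
  -- genuine deviation there, forcing `τ (c * M) ≥ T + 2 - η > T`.
  have hlate : T < τ (c * M) := by
    by_contra hle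
    have hin : ∀ m ≤ c * M, X m ∈ box N a b := fun m hm =>
      (htrack m hm ((hmono.monotone hm).trans (not_lt.1 hle))).1
    have h1 := (abs_le.1 (hS' _ le_rfl)).1
    have h2 : ∑ m ∈ Finset.range (c * M), timeNoise f TL TR a b M (X m) (w m) ≤
        ∑ m ∈ Finset.range (c * M), (τ (m + 1) - τ m - 1 / (M * ((N + 1) * K))) := by
      refine Finset.sum_le_sum fun m hm => ?_
      rw [htime m (hin m (Finset.mem_range.1 hm).le)]
      have := totalRate_le hK hTL hTR (hXpos m)
      have := hRpos m
      gcongr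
    rw [Finset.sum_sub_distrib, Finset.sum_range_sub, hτ0, Finset.sum_const, Finset.card_range,
      nsmul_eq_mul] at h2
    have h3 : T + 2 ≤ ((c * M : ℕ) : ℝ) * (1 / (M * ((N + 1) * K))) := by
      have : (N + 1) * K * (T + 2) ≤ c := Nat.le_ceil _
      push_cast
      rw [mul_one_div, le_div_iff₀ (by positivity)]
      nlinarith
    linarith [not_lt.1 hle]
  intro t ht
  have hset : {n : ℕ | jumpTime f TL TR E₀ w n ≤ M * t} = {n : ℕ | τ n ≤ t} := by
    ext n
    change jumpTime f TL TR E₀ w n ≤ M * t ↔ jumpTime f TL TR E₀ w n / M ≤ t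
    rw [div_le_iff₀ hM0, mul_comm]
  have hbdd : ∀ n, τ n ≤ t → n < c * M := fun n hn =>
    hmono.lt_iff_lt.1 ((hn.trans ht.2).trans_lt hlate)
  have hfast : fastProcess f TL TR E₀ M w t = X (sSup {n : ℕ | τ n ≤ t}) := by
    rw [fastProcess, slowProcess, hset]
  -- Boundedness matters: on an unbounded set of naturals `sSup` has the default value 0.
  have hba : BddAbove {n : ℕ | τ n ≤ t} := ⟨c * M, fun n hn => (hbdd n hn).le⟩
  have hmem : τ (sSup {n : ℕ | τ n ≤ t}) ≤ t :=
    Nat.sSup_mem (s := {n : ℕ | τ n ≤ t}) ⟨0, by simpa [hτ0] using ht.1⟩ hba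
  have hnot : t < τ (sSup {n : ℕ | τ n ≤ t} + 1) := by
    by_contra hcon
    have := le_csSup hba (show sSup {n : ℕ | τ n ≤ t} + 1 ∈ {n : ℕ | τ n ≤ t} from not_lt.1 hcon)
    omega
  rw [hfast, dist_eq_norm]
  set n := sSup {n : ℕ | τ n ≤ t} with hn
  obtain ⟨hXn, herr⟩ := htrack n (hbdd n hmem).le (hmem.trans ht.2)
  have h1 := norm_sub_le_of_solution hθ.deriv (fun s hs => hG s hs _ (by simpa using hδ.le)) hC
    (hτ0 ▸ hmono.monotone (Nat.zero_le n)) hmem ht.2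
  have h2 : C * (t - τ n) ≤ C * (3 * η) :=
    mul_le_mul_of_nonneg_left (by linarith [hstep n (hbdd n hmem) hXn]) C.2
  calc ‖X n - θ t‖ = ‖(X n - θ (τ n)) - (θ t - θ (τ n))‖ := by congr 1; abel
    _ ≤ ‖X n - θ (τ n)‖ + ‖θ t - θ (τ n)‖ := norm_sub_le _ _
    _ ≤ ε := by linarith [min_le_right δ ε]

end Paths

/-! ### The joint law of the noise in one step -/

section Sources

noncomputable instance : DecidableEq Source := Classical.decEq _

noncomputable instance : Fintype Source where
  elems := {.hold, .clock, .bath, .split, .beta₁, .beta₂}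
  complete s := by cases s <;> simp

lemma Source.prod_univ {R : Type*} [CommMonoid R] (g : Source → R) :
    ∏ s, g s = g .hold * g .clock * g .bath * g .split * g .beta₁ * g .beta₂ := by
  have : (Finset.univ : Finset Source) = {.hold, .clock, .bath, .split, .beta₁, .beta₂} := rfl
  rw [this]
  simp [mul_assoc]

instance isProbabilityMeasure_uniform :
    IsProbabilityMeasure ((volume : Measure ℝ).restrict (Set.Ioo 0 1)) :=
  ⟨by simp⟩

lemma Source.isProbabilityMeasure_law {M : ℕ} (hM : 2 ≤ M) (s : Source) :
    IsProbabilityMeasure (s.law M) := by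
  have h : (0 : ℝ) < M - 1 := by
    have : (2 : ℝ) ≤ M := by exact_mod_cast hM
    linarith
  have := isProbabilityMeasureBeta one_pos h
  cases s <;> simp only [Source.law] <;> infer_instance

/-- The density vanishes outside the open interval, whatever the parameters. -/
lemma ae_betaMeasure_mem_Ioo (α β : ℝ) : ∀ᵐ x ∂betaMeasure α β, x ∈ Set.Ioo (0 : ℝ) 1 := by
  rw [betaMeasure, ae_withDensity_iff (by unfold betaPDF; fun_prop)]
  refine Eventually.of_forall fun x hx => ?_
  by_contra hcon
  refine hx ?_
  rcases le_or_gt x 0 with h | h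
  · exact betaPDF_eq_zero_of_nonpos h
  · exact betaPDF_eq_zero_of_one_le (not_lt.1 fun h' => hcon ⟨h, h'⟩)

lemma Source.ae_law_mem_Ioo (M : ℕ) (s : Source) : ∀ᵐ x ∂s.law M, x ∈ Set.Ioo (0 : ℝ) 1 := by
  cases s <;> simp only [Source.law]
  iterate 4 exact ae_restrict_mem measurableSet_Ioo
  all_goals exact ae_betaMeasure_mem_Ioo _ _

/-- The joint law of the six sources in one step. -/
def noiseLaw (M : ℕ) : Measure (Source → ℝ) := Measure.pi fun s => s.law M

lemma isProbabilityMeasure_noiseLaw {M : ℕ} (hM : 2 ≤ M) : IsProbabilityMeasure (noiseLaw M) := by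
  have := fun s => Source.isProbabilityMeasure_law hM s
  unfold noiseLaw
  infer_instance

lemma ae_noiseLaw_mem_Ioo {M : ℕ} (hM : 2 ≤ M) :
    ∀ᵐ w ∂noiseLaw M, ∀ s, w s ∈ Set.Ioo (0 : ℝ) 1 := by
  have := fun s => Source.isProbabilityMeasure_law hM s
  rw [ae_all_iff]
  intro s
  exact (measurePreserving_eval (fun s : Source => s.law M) s).quasiMeasurePreserving.ae
    (Source.ae_law_mem_Ioo M s)

section Product

variable {M : ℕ}

lemma integral_noiseLaw_prod (hM : 2 ≤ M) (g₁ g₂ g₃ g₄ g₅ g₆ : ℝ → ℝ) :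
    ∫ w, g₁ (w .hold) * g₂ (w .clock) * g₃ (w .bath) * g₄ (w .split) * g₅ (w .beta₁) *
      g₆ (w .beta₂) ∂noiseLaw M =
    (∫ u in Set.Ioo 0 1, g₁ u) * (∫ u in Set.Ioo 0 1, g₂ u) * (∫ u in Set.Ioo 0 1, g₃ u) *
      (∫ u in Set.Ioo 0 1, g₄ u) * (∫ u, g₅ u ∂betaMeasure 1 ((M : ℝ) - 1)) *
      ∫ u, g₆ u ∂betaMeasure 1 ((M : ℝ) - 1) := by
  have := fun s => Source.isProbabilityMeasure_law hM s
  have h := integral_fintype_prod_eq_prod (𝕜 := ℝ) (μ := fun s : Source => s.law M)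
    (fun s : Source => Source.rec (motive := fun _ => ℝ → ℝ) g₁ g₂ g₃ g₄ g₅ g₆ s)
  simp only [Source.prod_univ] at h
  exact h

lemma integrable_noiseLaw_prod (hM : 2 ≤ M) {g₁ g₂ g₃ g₄ g₅ g₆ : ℝ → ℝ}
    (h₁ : IntegrableOn g₁ (Set.Ioo 0 1))
    (h₂ : IntegrableOn g₂ (Set.Ioo 0 1)) (h₃ : IntegrableOn g₃ (Set.Ioo 0 1))
    (h₄ : IntegrableOn g₄ (Set.Ioo 0 1)) (h₅ : Integrable g₅ (betaMeasure 1 ((M : ℝ) - 1)))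
    (h₆ : Integrable g₆ (betaMeasure 1 ((M : ℝ) - 1))) :
    Integrable (fun w => g₁ (w .hold) * g₂ (w .clock) * g₃ (w .bath) * g₄ (w .split) *
      g₅ (w .beta₁) * g₆ (w .beta₂)) (noiseLaw M) := by
  have := fun s => Source.isProbabilityMeasure_law hM s
  have h := Integrable.fintype_prod (𝕜 := ℝ) (μ := fun s : Source => s.law M)
    (f := fun s : Source => Source.rec (motive := fun _ => ℝ → ℝ) g₁ g₂ g₃ g₄ g₅ g₆ s)
    (fun s => by cases s <;> assumption)
  simp only [Source.prod_univ] at h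
  exact h

end Product

end Sources

/-! ### Moments of the exponential, uniform and Beta variables -/

section Moments

/-- The sixth power of `|log u| u^(1/12) < 12` gives the integrable majorant `12⁶ u^(-1/2)`;
reflection `u ↦ 1 - u` does the rest. -/
lemma integrableOn_log_one_sub_pow_six :
    IntegrableOn (fun u : ℝ => (-Real.log (1 - u)) ^ 6) (Set.Ioo 0 1) := by
  have h : IntegrableOn (fun u : ℝ => (-Real.log u) ^ 6) (Set.Ioc 0 1) := by
    have h1 : IntegrableOn (fun u : ℝ => 12 ^ 6 * u ^ (-(1 / 2) : ℝ)) (Set.Ioc 0 1) :=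
      ((intervalIntegrable_iff_integrableOn_Ioc_of_le zero_le_one).1
        (intervalIntegral.intervalIntegrable_rpow' (by norm_num))).const_mul _
    refine h1.mono' (by fun_prop) ?_
    filter_upwards [ae_restrict_mem measurableSet_Ioc] with u hu
    have h2 := (Real.abs_log_mul_self_rpow_lt u (1 / 12) hu.1 hu.2 (by norm_num)).le
    have h3 := pow_le_pow_left₀ (abs_nonneg _) h2 6
    rw [abs_mul, mul_pow, abs_of_pos (Real.rpow_pos_of_pos hu.1 _), ← Real.rpow_natCast (u ^ _),
      ← Real.rpow_mul hu.1.le] at h3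
    rw [norm_pow, norm_neg, Real.norm_eq_abs, Real.rpow_neg hu.1.le, ← div_eq_mul_inv,
      le_div_iff₀ (Real.rpow_pos_of_pos hu.1 _)]
    norm_num at h3 ⊢
    exact h3
  have h' := ((intervalIntegrable_iff_integrableOn_Ioc_of_le zero_le_one).2 h).comp_sub_left 1
  simp only [sub_zero, sub_self] at h'
  exact ((intervalIntegrable_iff_integrableOn_Ioc_of_le zero_le_one).1 h'.symm).mono_set
    Set.Ioo_subset_Ioc_self

lemma integrableOn_log_one_sub :
    IntegrableOn (fun u : ℝ => -Real.log (1 - u)) (Set.Ioo 0 1) := by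
  refine (integrableOn_log_one_sub_pow_six.add (integrable_const (1 : ℝ))).mono'
    (Real.measurable_log.comp (measurable_const.sub measurable_id)).neg.aestronglyMeasurable ?_
  refine Eventually.of_forall fun u => ?_
  simp only [Pi.add_apply, Real.norm_eq_abs]
  set x := -Real.log (1 - u)
  have h : |x| ^ 6 = x ^ 6 := by rw [pow_abs, abs_of_nonneg (by positivity)]
  rw [← h]
  rcases le_total |x| 1 with h | h
  · linarith [pow_nonneg (abs_nonneg x) 6]
  · linarith [le_self_pow₀ h (by norm_num : 6 ≠ 0)]

lemma integral_log_one_sub : ∫ u in Set.Ioo (0 : ℝ) 1, -Real.log (1 - u) = 1 := by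
  rw [← integral_Ioc_eq_integral_Ioo, ← intervalIntegral.integral_of_le zero_le_one,
    intervalIntegral.integral_neg,
    intervalIntegral.integral_comp_sub_left (fun u => Real.log u) 1]
  simp

lemma integral_uniform_id : ∫ u in Set.Ioo (0 : ℝ) 1, u = 1 / 2 := by
  rw [← integral_Ioc_eq_integral_Ioo, ← intervalIntegral.integral_of_le zero_le_one]
  simp

lemma integrableOn_of_continuous {g : ℝ → ℝ} (hg : Continuous g) :
    IntegrableOn g (Set.Ioo 0 1) :=
  (hg.continuousOn.integrableOn_compact isCompact_Icc).mono_set Set.Ioo_subset_Icc_self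

lemma integral_uniform_one_sub : ∫ u in Set.Ioo (0 : ℝ) 1, (1 - u) = 1 / 2 := by
  rw [integral_sub (g := fun u : ℝ => u) (integrable_const _)
    (integrableOn_of_continuous continuous_id),
    integral_uniform_id]
  norm_num

/-- Multiplying the Beta(α, β) density by `x ^ k` gives a constant multiple of the Beta(α + k, β)
density, which integrates to 1. -/
lemma integral_pow_betaMeasure {α β : ℝ} (hα : 0 < α) (hβ : 0 < β) (k : ℕ) :
    ∫ x, x ^ k ∂betaMeasure α β = beta (α + k) β / beta α β := by
  have hb := beta_pos hα hβ
  have hk : 0 < α + k := by positivity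
  have hb' := beta_pos hk hβ
  have hnn : 0 ≤ᵐ[betaMeasure α β] fun x => x ^ k := by
    filter_upwards [ae_betaMeasure_mem_Ioo α β] with x hx
    exact pow_nonneg hx.1.le k
  rw [integral_eq_lintegral_of_nonneg_ae hnn (by fun_prop), betaMeasure,
    lintegral_withDensity_eq_lintegral_mul _ (by unfold betaPDF; fun_prop) (by fun_prop)]
  have : ∀ x : ℝ, (betaPDF α β * fun x => ENNReal.ofReal (x ^ k)) x =
      ENNReal.ofReal (beta (α + k) β / beta α β) * betaPDF (α + k) β x := by
    intro x
    simp only [Pi.mul_apply, betaPDF]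
    by_cases hx : 0 < x ∧ x < 1
    · have h1 : 0 ≤ betaPDFReal α β x := (betaPDFReal_pos hx.1 hx.2 hα hβ).le
      rw [← ENNReal.ofReal_mul h1, ← ENNReal.ofReal_mul (by positivity)]
      congr 1
      simp only [betaPDFReal, if_pos hx]
      have h2 : x ^ (α + k - 1) = x ^ (α - 1) * x ^ k := by
        rw [← Real.rpow_natCast, ← Real.rpow_add hx.1]
        congr 1; ring
      rw [h2]
      field_simp
    · simp [betaPDFReal, hx]
  rw [lintegral_congr this, lintegral_const_mul _ (by unfold betaPDF; fun_prop),
    lintegral_betaPDF_eq_one hk hβ, mul_one, ENNReal.toReal_ofReal (by positivity)]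

lemma integrable_pow_betaMeasure {α β : ℝ} (hα : 0 < α) (hβ : 0 < β) (k : ℕ) :
    Integrable (fun x => x ^ k) (betaMeasure α β) := by
  have := isProbabilityMeasureBeta hα hβ
  refine (integrable_const (1 : ℝ)).mono' (by fun_prop) ?_
  filter_upwards [ae_betaMeasure_mem_Ioo α β] with x hx
  rw [norm_pow]
  exact pow_le_one₀ (norm_nonneg _) (by rw [Real.norm_of_nonneg hx.1.le]; exact hx.2.le)

lemma beta_one_eq {M : ℕ} (hM : 2 ≤ M) : beta 1 ((M : ℝ) - 1) = 1 / ((M : ℝ) - 1) := by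
  have h : (0 : ℝ) < M - 1 := by
    have : (2 : ℝ) ≤ M := by exact_mod_cast hM
    linarith
  have := Real.Gamma_pos_of_pos h
  rw [beta, Real.Gamma_one, add_comm, Real.Gamma_add_one h.ne']
  field_simp

lemma integral_id_betaMeasure {M : ℕ} (hM : 2 ≤ M) :
    ∫ x, x ∂betaMeasure 1 ((M : ℝ) - 1) = 1 / M := by
  have h : (0 : ℝ) < M - 1 := by
    have : (2 : ℝ) ≤ M := by exact_mod_cast hM
    linarith
  have h' : (0 : ℝ) < M := by linarith
  have hΓ := Real.Gamma_pos_of_pos h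
  have h1 := integral_pow_betaMeasure one_pos h 1
  simp only [pow_one] at h1
  have h2 : Real.Gamma (1 + (1 : ℕ) + ((M : ℝ) - 1)) = M * ((M - 1) * Real.Gamma (M - 1)) := by
    rw [← Real.Gamma_add_one h.ne', sub_add_cancel, ← Real.Gamma_add_one h'.ne']
    congr 1; push_cast; ring
  have h3 : Real.Gamma (1 + (1 : ℕ)) = 1 := by norm_num
  rw [h1, beta_one_eq hM, beta, h2, h3]
  field_simp

/-- The exact value is 6! / (M (M+1) ⋯ (M+5)). With the mean 1/M, this is the precise sense in which
the exchanged fractions are of order 1/M. -/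
lemma integral_pow_six_betaMeasure_le {M : ℕ} (hM : 2 ≤ M) :
    ∫ x, x ^ 6 ∂betaMeasure 1 ((M : ℝ) - 1) ≤ 720 / (M : ℝ) ^ 6 := by
  have h : (0 : ℝ) < M - 1 := by
    have : (2 : ℝ) ≤ M := by exact_mod_cast hM
    linarith
  have h' : (0 : ℝ) < M := by linarith
  have hΓ := Real.Gamma_pos_of_pos h
  have h2 : Real.Gamma (1 + (6 : ℕ) + ((M : ℝ) - 1)) =
      (M + 5) * ((M + 4) * ((M + 3) * ((M + 2) * ((M + 1) * (M * ((M - 1) *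
        Real.Gamma (M - 1))))))) := by
    rw [← Real.Gamma_add_one h.ne', sub_add_cancel, ← Real.Gamma_add_one h'.ne',
      ← Real.Gamma_add_one (by positivity)]
    rw [show (M : ℝ) + 2 = M + 1 + 1 by ring, ← Real.Gamma_add_one (by positivity),
      show (M : ℝ) + 3 = M + 1 + 1 + 1 by ring, ← Real.Gamma_add_one (by positivity),
      show (M : ℝ) + 4 = M + 1 + 1 + 1 + 1 by ring, ← Real.Gamma_add_one (by positivity),
      show (M : ℝ) + 5 = M + 1 + 1 + 1 + 1 + 1 by ring, ← Real.Gamma_add_one (by positivity)]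
    congr 1; push_cast; ring
  have h3 : Real.Gamma (1 + (6 : ℕ)) = 720 := by
    rw [add_comm, Real.Gamma_nat_eq_factorial]
    norm_num [Nat.factorial]
  rw [integral_pow_betaMeasure one_pos h 6, beta_one_eq hM, beta, h2, h3]
  have h4 : (720 * Real.Gamma ((M : ℝ) - 1) / ((M + 5) * ((M + 4) * ((M + 3) * ((M + 2) *
      ((M + 1) * (M * ((M - 1) * Real.Gamma (M - 1)))))))) / (1 / ((M : ℝ) - 1))) =
      720 / ((M + 5) * ((M + 4) * ((M + 3) * ((M + 2) * ((M + 1) * M))))) := by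
    field_simp
  rw [h4]
  refine div_le_div_of_nonneg_left (by norm_num) (by positivity) ?_
  calc (M : ℝ) ^ 6 = M * (M * (M * (M * (M * M)))) := by ring
    _ ≤ _ := by gcongr <;> linarith

end Moments

/-! ### Joint measurability in the state and the noise, for a measurable rate -/

section Measurability

variable {N : ℕ} {f : ℝ → ℝ → ℝ} {TL TR : ℝ}

lemma measurable_clockRate (hf : Measurable (Function.uncurry f)) (k : Fin (N + 1)) :
    Measurable (fun E : Fin N → ℝ => clockRate f TL TR E k) := by
  have hch : ∀ j, Measurable fun E : Fin N → ℝ => chain TL TR E j :=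
    measurable_chain measurable_const measurable_const measurable_id
  exact hf.comp ((hch k.castSucc).prodMk (hch k.succ))

lemma measurable_totalRate (hf : Measurable (Function.uncurry f)) :
    Measurable (fun E : Fin N → ℝ => totalRate f TL TR E) :=
  Finset.measurable_sum _ fun k _ => measurable_clockRate hf k

lemma measurableSet_chosen (hf : Measurable (Function.uncurry f)) (k : Fin (N + 1)) :
    MeasurableSet {p : (Fin N → ℝ) × (Source → ℝ) | Chosen f TL TR p.1 (p.2 .clock) k} := by
  have hk : ∀ j, Measurable fun p : (Fin N → ℝ) × (Source → ℝ) => clockRate f TL TR p.1 j :=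
    fun j => (measurable_clockRate hf j).comp measurable_fst
  have hR : Measurable fun p : (Fin N → ℝ) × (Source → ℝ) =>
      p.2 .clock * totalRate f TL TR p.1 :=
    ((measurable_pi_apply _).comp measurable_snd).mul ((measurable_totalRate hf).comp measurable_fst)
  exact (measurableSet_le (Finset.measurable_sum _ fun j _ => hk j) hR).inter
    (measurableSet_lt hR (Finset.measurable_sum _ fun j _ => hk j))

lemma measurable_mul_log_one_sub (c : ℝ) : Measurable fun u : ℝ => c * Real.log (1 - u) :=
  (Real.measurable_log.comp (measurable_const.sub measurable_id)).const_mul c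

lemma measurable_flux (k : Fin (N + 1)) :
    Measurable (fun p : (Fin N → ℝ) × (Source → ℝ) => flux TL TR p.1 p.2 k) := by
  have hs : ∀ s : Source, Measurable fun p : (Fin N → ℝ) × (Source → ℝ) => p.2 s :=
    fun s => (measurable_pi_apply s).comp measurable_snd
  have hch : ∀ j, Measurable fun p : (Fin N → ℝ) × (Source → ℝ) =>
      chain (-TL * Real.log (1 - p.2 .bath)) (-TR * Real.log (1 - p.2 .bath)) p.1 j :=
    measurable_chain ((measurable_mul_log_one_sub (-TL)).comp (hs .bath))
      ((measurable_mul_log_one_sub (-TR)).comp (hs .bath)) measurable_fst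
  exact (((measurable_const.sub (hs .split)).mul (hs .beta₁)).mul (hch _)).sub
    (((hs .split).mul (hs .beta₂)).mul (hch _))

lemma measurable_increment (hf : Measurable (Function.uncurry f)) :
    Measurable (fun p : (Fin N → ℝ) × (Source → ℝ) => increment f TL TR p.1 p.2) := by
  rw [measurable_pi_iff]
  intro i
  exact (Measurable.ite (measurableSet_chosen hf _) (measurable_flux _) measurable_const).sub
    (Measurable.ite (measurableSet_chosen hf _) (measurable_flux _) measurable_const)

lemma measurable_drift (hf : Measurable (Function.uncurry f)) (i : Fin N) :
    Measurable (fun E : Fin N → ℝ => drift f TL TR E i) := by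
  have hch : ∀ j, Measurable fun E : Fin N → ℝ => chain TL TR E j :=
    measurable_chain measurable_const measurable_const measurable_id
  have hi : Measurable fun E : Fin N → ℝ => E i := measurable_pi_apply i
  have hl := hch i.castSucc.castSucc
  have hr := hch i.succ.succ
  exact (((hf.comp (hl.prodMk hi)).const_mul (1 / 2)).mul (hl.sub hi)).add
    (((hf.comp (hi.prodMk hr)).const_mul (1 / 2)).mul (hr.sub hi))

lemma measurable_holdExp : Measurable holdExp := by
  have h : Measurable fun w : Source → ℝ => w .hold := measurable_pi_apply _
  exact (Real.measurable_log.comp (measurable_const.sub h)).neg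

lemma measurable_energyNoise (hf : Measurable (Function.uncurry f)) (a b : ℝ) (M : ℕ) (i : Fin N) :
    Measurable (fun p : (Fin N → ℝ) × (Source → ℝ) =>
      energyNoise f TL TR a b M i p.1 p.2) := by
  refine Measurable.ite (measurable_fst measurableSet_Icc) ?_ measurable_const
  exact ((measurable_pi_apply i).comp (measurable_increment hf)).sub
    (((measurable_drift hf i).comp measurable_fst).mul ((measurable_holdExp.comp measurable_snd).div
      (measurable_const.mul ((measurable_totalRate hf).comp measurable_fst))))

lemma measurable_timeNoise (hf : Measurable (Function.uncurry f)) (a b : ℝ) (M : ℕ) :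
    Measurable (fun p : (Fin N → ℝ) × (Source → ℝ) => timeNoise f TL TR a b M p.1 p.2) := by
  refine Measurable.ite (measurable_fst measurableSet_Icc) ?_ measurable_const
  exact ((measurable_holdExp.comp measurable_snd).sub measurable_const).div
      (measurable_const.mul ((measurable_totalRate hf).comp measurable_fst))

end Measurability

/-! ### The noise is centred -/

section Mean

variable {N : ℕ} {f : ℝ → ℝ → ℝ} {TL TR : ℝ}

lemma setOf_chosen_eq_Ico {E : Fin N → ℝ} (hR : 0 < totalRate f TL TR E) (k : Fin (N + 1)) :
    {u | Chosen f TL TR E u k} = Set.Ico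
      ((∑ j ∈ Finset.Iio k, clockRate f TL TR E j) / totalRate f TL TR E)
      ((∑ j ∈ Finset.Iic k, clockRate f TL TR E j) / totalRate f TL TR E) := by
  ext u
  change _ ∧ _ ↔ _ ≤ u ∧ u < _
  rw [div_le_iff₀ hR, lt_div_iff₀ hR]

/-- The choice interval of clock `k` has length f_k / R and lies in `[0, 1)`, so restricting to the
unit interval loses nothing. -/
lemma volume_chosen (hf : IsRateFunction f) (hTL : 0 < TL) (hTR : 0 < TR) {E : Fin N → ℝ}
    (hE : ∀ i, 0 < E i) (k : Fin (N + 1)) :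
    (volume.restrict (Set.Ioo 0 1)).real {u : ℝ | Chosen f TL TR E u k} =
      clockRate f TL TR E k / totalRate f TL TR E := by
  have hR := totalRate_pos hf hTL hTR hE
  have hk := fun j => clockRate_pos hf hTL hTR hE j
  have hsub : Set.Ico ((∑ j ∈ Finset.Iio k, clockRate f TL TR E j) / totalRate f TL TR E)
      ((∑ j ∈ Finset.Iic k, clockRate f TL TR E j) / totalRate f TL TR E) ⊆ Set.Ico 0 1 := by
    refine Set.Ico_subset_Ico (div_nonneg (Finset.sum_nonneg fun j _ => (hk j).le) hR.le) ?_
    rw [div_le_one hR]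
    exact Finset.sum_le_univ_sum_of_nonneg fun j => (hk j).le
  rw [setOf_chosen_eq_Ico hR, Measure.restrict_congr_set Ioo_ae_eq_Ico, measureReal_def,
    Measure.restrict_apply measurableSet_Ico, Set.inter_eq_left.2 hsub, Real.volume_Ico,
    ← Finset.Iio_insert, Finset.sum_insert (by simp), ← sub_div, add_sub_cancel_right,
    ENNReal.toReal_ofReal (div_pos (hk k) hR).le]

lemma integrableOn_chain_bath (E : Fin N → ℝ) (j : Fin (N + 2)) :
    IntegrableOn (fun u => chain (-TL * Real.log (1 - u)) (-TR * Real.log (1 - u)) E j)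
      (Set.Ioo 0 1) := by
  rcases position_cases j with rfl | rfl | ⟨i, rfl⟩
  · simpa only [chain_zero, neg_mul_comm] using! integrableOn_log_one_sub.const_mul TL
  · simpa only [chain_last, neg_mul_comm] using! integrableOn_log_one_sub.const_mul TR
  · simp only [chain_castSucc_succ]
    exact integrable_const _

lemma integral_chain_bath (E : Fin N → ℝ) (j : Fin (N + 2)) :
    ∫ u in Set.Ioo (0 : ℝ) 1, chain (-TL * Real.log (1 - u)) (-TR * Real.log (1 - u)) E j =
      chain TL TR E j := by
  have h : ∀ c : ℝ, ∫ u in Set.Ioo (0 : ℝ) 1, -c * Real.log (1 - u) = c := by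
    intro c
    simp only [neg_mul_comm]
    rw [integral_const_mul, integral_log_one_sub, mul_one]
  rcases position_cases j with rfl | rfl | ⟨i, rfl⟩
  · simpa only [chain_zero] using h TL
  · simpa only [chain_last] using h TR
  · simp

-- By independence the two terms of the flux factor: f_k / R for the clock, 1/2 for the split, 1/M
-- for the Beta fraction, and the mean energy, where an exponential bath energy averages to its
-- temperature.
open Classical in
lemma integral_chosen_flux (hf : IsRateFunction f) (hTL : 0 < TL) (hTR : 0 < TR) {E : Fin N → ℝ}
    (hE : ∀ i, 0 < E i) {M : ℕ} (hM : 2 ≤ M) (k : Fin (N + 1)) :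
    Integrable (fun w : Source → ℝ => if Chosen f TL TR E (w .clock) k then flux TL TR E w k else 0)
      (noiseLaw M) ∧
    ∫ w : Source → ℝ, (if Chosen f TL TR E (w .clock) k then flux TL TR E w k else 0) ∂noiseLaw M =
      clockRate f TL TR E k / totalRate f TL TR E * (1 / (2 * M)) *
        (chain TL TR E k.castSucc - chain TL TR E k.succ) := by
  have hM1 : (0 : ℝ) < M - 1 := by
    have : (2 : ℝ) ≤ M := by exact_mod_cast hM
    linarith
  have := isProbabilityMeasureBeta one_pos hM1
  set A : Set ℝ := {u | Chosen f TL TR E u k} with hA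
  have hAm : MeasurableSet A := by
    rw [hA, setOf_chosen_eq_Ico (totalRate_pos hf hTL hTR hE)]
    exact measurableSet_Ico
  set g : Fin (N + 2) → ℝ → ℝ := fun j u =>
    chain (-TL * Real.log (1 - u)) (-TR * Real.log (1 - u)) E j with hg
  -- Each term is padded with factors 1 to a product of six one-source functions, the form to which
  -- Fubini applies.
  have hdec : (fun w : Source → ℝ =>
      if Chosen f TL TR E (w .clock) k then flux TL TR E w k else 0) = fun w =>
      1 * A.indicator 1 (w .clock) * g k.castSucc (w .bath) * (1 - w .split) * w .beta₁ * 1 -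
      1 * A.indicator 1 (w .clock) * g k.succ (w .bath) * w .split * 1 * w .beta₂ := by
    funext w
    by_cases hw : Chosen f TL TR E (w .clock) k
    · have : w .clock ∈ A := hw
      simp only [if_pos hw, Set.indicator_of_mem this, flux, hg, Pi.one_apply]
      ring
    · have : w .clock ∉ A := hw
      simp only [if_neg hw, Set.indicator_of_notMem this]
      ring
  have hone : IntegrableOn (fun _ : ℝ => (1 : ℝ)) (Set.Ioo 0 1) := integrable_const _
  have hAi : IntegrableOn (A.indicator (1 : ℝ → ℝ)) (Set.Ioo 0 1) :=
    (integrable_const (1 : ℝ)).indicator hAm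
  have hAint : ∫ u in Set.Ioo 0 1, A.indicator (1 : ℝ → ℝ) u =
      clockRate f TL TR E k / totalRate f TL TR E := by
    rw [integral_indicator_one hAm, volume_chosen hf hTL hTR hE]
  have hid : Integrable (fun x : ℝ => x) (betaMeasure 1 ((M : ℝ) - 1)) := by
    simpa using integrable_pow_betaMeasure one_pos hM1 1
  have h1 := integrable_noiseLaw_prod hM hone hAi (integrableOn_chain_bath (TL := TL) (TR := TR) E
    k.castSucc) (integrableOn_of_continuous (continuous_sub_left (1 : ℝ))) hid
    (integrable_const (1 : ℝ))
  have h2 := integrable_noiseLaw_prod hM hone hAi (integrableOn_chain_bath (TL := TL) (TR := TR) E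
    k.succ) (integrableOn_of_continuous continuous_id) (integrable_const (1 : ℝ)) hid
  have e1 := integral_noiseLaw_prod hM (fun _ => 1) (A.indicator 1) (g k.castSucc)
    (fun u => 1 - u) (fun x => x) (fun _ => 1)
  have e2 := integral_noiseLaw_prod hM (fun _ => 1) (A.indicator 1) (g k.succ)
    (fun u => u) (fun _ => 1) (fun x => x)
  rw [hAint, integral_chain_bath, integral_id_betaMeasure hM] at e1 e2
  rw [integral_uniform_one_sub] at e1
  rw [integral_uniform_id] at e2
  simp only [integral_const, probReal_univ, smul_eq_mul, mul_one] at e1 e2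
  rw [hdec]
  refine ⟨h1.sub h2, (integral_sub h1 h2).trans ?_⟩
  simp only [id, mul_one]
  rw [e1, e2]
  have : (M : ℝ) ≠ 0 := by positivity
  field_simp

lemma integral_increment (hf : IsRateFunction f) (hTL : 0 < TL) (hTR : 0 < TR) {E : Fin N → ℝ}
    (hE : ∀ i, 0 < E i) {M : ℕ} (hM : 2 ≤ M) (i : Fin N) :
    Integrable (fun w : Source → ℝ => increment f TL TR E w i) (noiseLaw M) ∧
    ∫ w : Source → ℝ, increment f TL TR E w i ∂noiseLaw M =
      drift f TL TR E i / (M * totalRate f TL TR E) := by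
  obtain ⟨hl, el⟩ := integral_chosen_flux hf hTL hTR hE hM i.castSucc
  obtain ⟨hr, er⟩ := integral_chosen_flux hf hTL hTR hE hM i.succ
  refine ⟨hl.sub hr, ?_⟩
  simp only [increment]
  rw [integral_sub hl hr, el, er]
  simp only [clockRate, drift, chain_castSucc_succ, chain_succ_castSucc]
  have h1 : (M : ℝ) ≠ 0 := by positivity
  have h2 := (totalRate_pos hf hTL hTR hE).ne'
  field_simp
  ring

lemma integral_holdExp {M : ℕ} (hM : 2 ≤ M) :
    Integrable holdExp (noiseLaw M) ∧ ∫ w, holdExp w ∂noiseLaw M = 1 := by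
  have hM1 : (0 : ℝ) < M - 1 := by
    have : (2 : ℝ) ≤ M := by exact_mod_cast hM
    linarith
  have := isProbabilityMeasureBeta one_pos hM1
  have hone : IntegrableOn (fun _ : ℝ => (1 : ℝ)) (Set.Ioo 0 1) := integrable_const _
  have h := integrable_noiseLaw_prod hM integrableOn_log_one_sub hone hone hone
    (integrable_const 1) (integrable_const 1)
  have e := integral_noiseLaw_prod hM (fun u => -Real.log (1 - u)) (fun _ => 1) (fun _ => 1)
    (fun _ => 1) (fun _ => 1) (fun _ => 1)
  rw [integral_log_one_sub] at e
  simp only [integral_const, probReal_univ, smul_eq_mul, mul_one] at e h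
  exact ⟨h, e⟩

/-- The exponential variable has mean 1, so the drift times the waiting time has the same mean
`drift / (M R)` as the increment. -/
lemma integral_energyNoise (hf : IsRateFunction f) (hTL : 0 < TL) (hTR : 0 < TR) {a b : ℝ}
    (ha : 0 < a) {M : ℕ} (hM : 2 ≤ M) (i : Fin N) (E : Fin N → ℝ) :
    ∫ w, energyNoise f TL TR a b M i E w ∂noiseLaw M = 0 := by
  by_cases hE : E ∈ box N a b
  · have hE' : ∀ i, 0 < E i := fun i => ha.trans_le (mem_box.1 hE i).1
    obtain ⟨h1, e1⟩ := integral_increment hf hTL hTR hE' hM i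
    obtain ⟨h2, e2⟩ := integral_holdExp hM
    simp only [energyNoise, if_pos hE]
    rw [integral_sub h1 ((h2.div_const _).const_mul _), e1, integral_const_mul, integral_div, e2]
    ring
  · simp [energyNoise, hE]

lemma integral_timeNoise {a b : ℝ} {M : ℕ} (hM : 2 ≤ M) (E : Fin N → ℝ) :
    ∫ w, timeNoise f TL TR a b M E w ∂noiseLaw M = 0 := by
  have := isProbabilityMeasure_noiseLaw hM
  by_cases hE : E ∈ box N a b
  · obtain ⟨h2, e2⟩ := integral_holdExp hM
    simp only [timeNoise, if_pos hE]
    rw [integral_div, integral_sub h2 (integrable_const _), e2]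
    simp
  · simp [timeNoise, hE]

end Mean

/-! ### Sixth moments of the rescaled noise, uniformly in M and in the state -/

section SixthMoments

/-- The sixth moment of a standard exponential variable. -/
def expSixthMoment : ℝ := ∫ u in Set.Ioo (0 : ℝ) 1, (-Real.log (1 - u)) ^ 6

lemma expSixthMoment_nonneg : 0 ≤ expSixthMoment :=
  integral_nonneg fun u => by positivity

lemma integral_holdExp_pow_six {M : ℕ} (hM : 2 ≤ M) :
    Integrable (fun w => holdExp w ^ 6) (noiseLaw M) ∧
      ∫ w, holdExp w ^ 6 ∂noiseLaw M = expSixthMoment := by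
  have hM1 : (0 : ℝ) < M - 1 := by
    have : (2 : ℝ) ≤ M := by exact_mod_cast hM
    linarith
  have := isProbabilityMeasureBeta one_pos hM1
  have hone : IntegrableOn (fun _ : ℝ => (1 : ℝ)) (Set.Ioo 0 1) := integrable_const _
  have h := integrable_noiseLaw_prod hM integrableOn_log_one_sub_pow_six hone hone hone
    (integrable_const 1) (integrable_const 1)
  have e := integral_noiseLaw_prod hM (fun u => (-Real.log (1 - u)) ^ 6) (fun _ => 1) (fun _ => 1)
    (fun _ => 1) (fun _ => 1) (fun _ => 1)
  simp only [integral_const, probReal_univ, smul_eq_mul, mul_one] at e h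
  exact ⟨h, e⟩

lemma integral_bath_mul_beta_pow_six {M : ℕ} (hM : 2 ≤ M) {c d : ℝ} (hc : 0 ≤ c) (hd : 0 ≤ d) :
    Integrable (fun w => (c + d * (-Real.log (1 - w .bath)) ^ 6) *
        (w .beta₁ ^ 6 + w .beta₂ ^ 6)) (noiseLaw M) ∧
      ∫ w, (c + d * (-Real.log (1 - w .bath)) ^ 6) * (w .beta₁ ^ 6 + w .beta₂ ^ 6) ∂noiseLaw M ≤
        (c + d * expSixthMoment) * (1440 / (M : ℝ) ^ 6) := by
  have hM1 : (0 : ℝ) < M - 1 := by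
    have : (2 : ℝ) ≤ M := by exact_mod_cast hM
    linarith
  have := isProbabilityMeasureBeta one_pos hM1
  have hone : IntegrableOn (fun _ : ℝ => (1 : ℝ)) (Set.Ioo 0 1) := integrable_const _
  have hconst : IntegrableOn (fun _ : ℝ => c) (Set.Ioo 0 1) := integrable_const _
  have hlog := integrableOn_log_one_sub_pow_six.const_mul d
  have hb := integrable_pow_betaMeasure one_pos hM1 6
  have h1 := integrable_noiseLaw_prod hM hone hone (hconst.add hlog) hone hb (integrable_const 1)
  have h2 := integrable_noiseLaw_prod hM hone hone (hconst.add hlog) hone (integrable_const 1) hb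
  have e1 := integral_noiseLaw_prod hM (fun _ => 1) (fun _ => 1)
    (fun u => c + d * (-Real.log (1 - u)) ^ 6) (fun _ => 1) (fun x => x ^ 6) (fun _ => 1)
  have e2 := integral_noiseLaw_prod hM (fun _ => 1) (fun _ => 1)
    (fun u => c + d * (-Real.log (1 - u)) ^ 6) (fun _ => 1) (fun _ => 1) (fun x => x ^ 6)
  have e3 : ∫ u in Set.Ioo (0 : ℝ) 1, (c + d * (-Real.log (1 - u)) ^ 6) =
      c + d * expSixthMoment := by
    rw [integral_add hconst hlog, integral_const_mul, expSixthMoment]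
    simp
  simp only [Pi.add_apply, integral_const, probReal_univ, smul_eq_mul, mul_one, one_mul, e3]
    at e1 e2 h1 h2
  simp only [mul_add]
  refine ⟨h1.add h2, ?_⟩
  rw [integral_add h1 h2, e1, e2]
  have hle := mul_le_mul_of_nonneg_left (integral_pow_six_betaMeasure_le hM)
    (add_nonneg hc (mul_nonneg hd expSixthMoment_nonneg))
  calc _ ≤ (c + d * expSixthMoment) * (720 / (M : ℝ) ^ 6) +
        (c + d * expSixthMoment) * (720 / (M : ℝ) ^ 6) := add_le_add hle hle
    _ = _ := by ring

/-- Convexity of the sixth power; 32 = 2⁵. -/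
lemma pow_six_le_of_abs_le_add {x y z : ℝ} (hy : 0 ≤ y) (hz : 0 ≤ z) (h : |x| ≤ y + z) :
    x ^ 6 ≤ 32 * (y ^ 6 + z ^ 6) := by
  have h1 : x ^ 6 = |x| ^ 6 := by rw [pow_abs, abs_of_nonneg (by positivity)]
  rw [h1]
  refine (pow_le_pow_left₀ (abs_nonneg _) h 6).trans ((add_pow_le hy hz 6).trans_eq ?_)
  norm_num

variable {N : ℕ} {f : ℝ → ℝ → ℝ} {TL TR : ℝ}

/-- In the box both energies involved are at most `|b| + (TL + TR) Y`, with `Y` the standard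
exponential behind the bath energies, and the split weights are at most 1. -/
lemma abs_flux_le (hTL : 0 < TL) (hTR : 0 < TR) {a b : ℝ} (ha : 0 < a) {E : Fin N → ℝ}
    (hE : E ∈ box N a b) {w : Source → ℝ} (hw : ∀ s, w s ∈ Set.Ioo (0 : ℝ) 1) (k : Fin (N + 1)) :
    |flux TL TR E w k| ≤
      (w .beta₁ + w .beta₂) * (|b| + (TL + TR) * -Real.log (1 - w .bath)) := by
  have hY : 0 < -Real.log (1 - w .bath) := by
    simpa using neg_mul_log_one_sub_pos one_pos (hw .bath)
  have hE' : ∀ i, 0 < E i := fun i => ha.trans_le (mem_box.1 hE i).1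
  have hpos := chain_pos (neg_mul_log_one_sub_pos hTL (hw .bath))
    (neg_mul_log_one_sub_pos hTR (hw .bath)) hE'
  have h1 := mul_pos hTL hY
  have h2 := mul_pos hTR hY
  have hle := chain_le (a := -TL * Real.log (1 - w .bath)) (b := -TR * Real.log (1 - w .bath))
    (c := |b| + (TL + TR) * -Real.log (1 - w .bath)) (E := E)
    (by linarith [abs_nonneg b]) (by linarith [abs_nonneg b])
    (fun i => by linarith [(mem_box.1 hE i).2, le_abs_self b])
  set Q := |b| + (TL + TR) * -Real.log (1 - w .bath) with hQ
  have hp := hw .split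
  have h3 : ∀ q x B : ℝ, 0 ≤ q → q ≤ 1 → 0 ≤ B → 0 ≤ x → x ≤ Q →
      0 ≤ q * B * x ∧ q * B * x ≤ B * Q := by
    intro q x B hq hq1 hB hx hxQ
    refine ⟨by positivity, ?_⟩
    exact mul_le_mul (mul_le_of_le_one_left hB hq1) hxQ hx hB
  have h4 := h3 (1 - w .split) _ _ (by linarith [hp.2]) (by linarith [hp.1]) (hw .beta₁).1.le
    (hpos k.castSucc).le (hle k.castSucc)
  have h5 := h3 (w .split) _ _ hp.1.le hp.2.le (hw .beta₂).1.le (hpos k.succ).le (hle k.succ)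
  simp only [flux]
  rw [abs_le]
  constructor <;> linarith [h4.1, h4.2, h5.1, h5.2, mul_nonneg (hw .beta₁).1.le (h4.1.trans h4.2),
    add_mul (w .beta₁) (w .beta₂) Q]

lemma abs_increment_le (hTL : 0 < TL) (hTR : 0 < TR) {a b : ℝ} (ha : 0 < a) {E : Fin N → ℝ}
    (hE : E ∈ box N a b) {w : Source → ℝ} (hw : ∀ s, w s ∈ Set.Ioo (0 : ℝ) 1) (i : Fin N) :
    |increment f TL TR E w i| ≤
      2 * ((w .beta₁ + w .beta₂) * (|b| + (TL + TR) * -Real.log (1 - w .bath))) := by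
  have h1 := abs_le.1 (abs_flux_le hTL hTR ha hE hw i.castSucc)
  have h2 := abs_le.1 (abs_flux_le hTL hTR ha hE hw i.succ)
  simp only [increment]
  rw [abs_le]
  split_ifs <;> constructor <;> linarith

/-- The increment carries a factor `B₁ + B₂`, whose sixth moment is O(M⁻⁶) and cancels `M ^ 6`; the
drift part is at most `D / r` times an exponential variable after rescaling. -/
lemma exists_energyNoise_sixth_moment_le (hf : IsRateFunction f)
    (hfm : Measurable (Function.uncurry f)) {a b : ℝ} (ha : 0 < a) (haL : a ≤ TL) (haR : a ≤ TR) :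
    ∃ C : ℝ, ∀ M : ℕ, 2 ≤ M → ∀ (i : Fin N) (E : Fin N → ℝ),
      Integrable (fun w => (M * energyNoise f TL TR a b M i E w) ^ 6) (noiseLaw M) ∧
        ∫ w, (M * energyNoise f TL TR a b M i E w) ^ 6 ∂noiseLaw M ≤ C := by
  have hTL := ha.trans_le haL
  have hTR := ha.trans_le haR
  obtain ⟨D, hD⟩ := exists_bound_drift (N := N) (b := b) hf hTL hTR ha
  have hr := hf.pos a a ha ha
  set r := f a a with hr_def
  have hm := expSixthMoment_nonneg
  set c : ℝ := |b| ^ 6 with hc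
  set d : ℝ := (TL + TR) ^ 6 with hd
  have hc0 : 0 ≤ c := by positivity
  have hd0 : 0 ≤ d := by positivity
  have hD0 : (0 : ℝ) ≤ D := D.2
  refine ⟨32 * (65536 * (c + d * expSixthMoment) * 1440 + (D / r) ^ 6 * expSixthMoment),
    fun M hM i E => ?_⟩
  have hM0 : (0 : ℝ) < M := by positivity
  by_cases hE : E ∈ box N a b
  swap
  · have : 0 ≤ 32 * (65536 * (c + d * expSixthMoment) * 1440 +
      (D / r) ^ 6 * expSixthMoment) := by positivity
    simpa [energyNoise, hE] using this
  obtain ⟨i1, m1⟩ := integral_bath_mul_beta_pow_six hM hc0 hd0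
  obtain ⟨i2, m2⟩ := integral_holdExp_pow_six hM
  have hH := ((i1.const_mul ((M : ℝ) ^ 6 * 65536)).add (i2.const_mul ((D / r) ^ 6))).const_mul 32
  have hle : ∀ᵐ w ∂noiseLaw M, (M * energyNoise f TL TR a b M i E w) ^ 6 ≤
      32 * ((M : ℝ) ^ 6 * 65536 * ((c + d * (-Real.log (1 - w .bath)) ^ 6) *
        (w .beta₁ ^ 6 + w .beta₂ ^ 6)) + (D / r) ^ 6 * holdExp w ^ 6) := by
    filter_upwards [ae_noiseLaw_mem_Ioo hM] with w hw
    have hY : 0 < -Real.log (1 - w .bath) := by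
      simpa using neg_mul_log_one_sub_pos one_pos (hw .bath)
    have hb1 := (hw .beta₁).1
    have hb2 := (hw .beta₂).1
    have he := holdExp_pos hw
    have hR : r ≤ totalRate f TL TR E := le_totalRate hf ha haL haR fun i => (mem_box.1 hE i).1
    have hR0 := hr.trans_le hR
    set y := M * (2 * ((w .beta₁ + w .beta₂) * (|b| + (TL + TR) * -Real.log (1 - w .bath))))
      with hy
    have hy0 : 0 ≤ y := by positivity
    have habs : |M * energyNoise f TL TR a b M i E w| ≤ y + D / r * holdExp w := by
      rw [energyNoise, if_pos hE, mul_sub]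
      refine (abs_sub _ _).trans (add_le_add ?_ ?_)
      · rw [abs_mul, abs_of_pos hM0]
        exact mul_le_mul_of_nonneg_left (abs_increment_le hTL hTR ha hE hw i) hM0.le
      · have h1 : (M : ℝ) * (drift f TL TR E i * (holdExp w / (M * totalRate f TL TR E))) =
            drift f TL TR E i / totalRate f TL TR E * holdExp w := by field_simp
        rw [h1, abs_mul, abs_of_pos he, abs_div, abs_of_pos hR0]
        have h2 : |drift f TL TR E i| ≤ D := (norm_le_pi_norm (drift f TL TR E) i).trans (hD E hE)
        gcongr
    refine (pow_six_le_of_abs_le_add hy0 (by positivity) habs).trans ?_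
    have h3 : (w .beta₁ + w .beta₂) ^ 6 ≤ 32 * (w .beta₁ ^ 6 + w .beta₂ ^ 6) :=
      (add_pow_le hb1.le hb2.le 6).trans_eq (by norm_num)
    have h4 : (|b| + (TL + TR) * -Real.log (1 - w .bath)) ^ 6 ≤
        32 * (c + d * (-Real.log (1 - w .bath)) ^ 6) :=
      (add_pow_le (abs_nonneg b) (by positivity) 6).trans_eq (by rw [hc, hd, mul_pow]; norm_num)
    -- 65536 = 2⁶ · 32 · 32: the factor 2 in `y`, and one convexity constant for each of the two
    -- sums.
    have h5 : y ^ 6 ≤ (M : ℝ) ^ 6 * 65536 * ((c + d * (-Real.log (1 - w .bath)) ^ 6) *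
        (w .beta₁ ^ 6 + w .beta₂ ^ 6)) := by
      calc y ^ 6 = (M : ℝ) ^ 6 * 64 * ((w .beta₁ + w .beta₂) ^ 6 *
            (|b| + (TL + TR) * -Real.log (1 - w .bath)) ^ 6) := by rw [hy]; ring
        _ ≤ (M : ℝ) ^ 6 * 64 * ((32 * (w .beta₁ ^ 6 + w .beta₂ ^ 6)) *
            (32 * (c + d * (-Real.log (1 - w .bath)) ^ 6))) := by gcongr
        _ = _ := by ring
    rw [mul_pow (D / r : ℝ)]
    linarith
  have hmeas : Measurable fun w => (M * energyNoise f TL TR a b M i E w) ^ 6 :=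
    (((measurable_energyNoise hfm a b M i).comp measurable_prodMk_left).const_mul _).pow_const 6
  have hint := hH.mono' hmeas.aestronglyMeasurable (by
    filter_upwards [hle] with w h
    rwa [Real.norm_of_nonneg (by positivity)])
  refine ⟨hint, (integral_mono_ae hint hH hle).trans ?_⟩
  have e : ∫ w, 32 * ((M : ℝ) ^ 6 * 65536 * ((c + d * (-Real.log (1 - w .bath)) ^ 6) *
        (w .beta₁ ^ 6 + w .beta₂ ^ 6)) + (D / r) ^ 6 * holdExp w ^ 6) ∂noiseLaw M =
      32 * ((M : ℝ) ^ 6 * 65536 * (∫ w, (c + d * (-Real.log (1 - w .bath)) ^ 6) *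
        (w .beta₁ ^ 6 + w .beta₂ ^ 6) ∂noiseLaw M) + (D / r) ^ 6 * expSixthMoment) := by
    rw [integral_const_mul, integral_add (i1.const_mul _) (i2.const_mul _), integral_const_mul,
      integral_const_mul, m2]
  refine e.trans_le ?_
  have : (M : ℝ) ^ 6 * 65536 * (∫ w, (c + d * (-Real.log (1 - w .bath)) ^ 6) *
        (w .beta₁ ^ 6 + w .beta₂ ^ 6) ∂noiseLaw M) ≤
      65536 * (c + d * expSixthMoment) * 1440 := by
    refine (mul_le_mul_of_nonneg_left m1 (by positivity)).trans_eq ?_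
    field_simp
  linarith

lemma exists_timeNoise_sixth_moment_le (hf : IsRateFunction f)
    (hfm : Measurable (Function.uncurry f)) {a b : ℝ} (ha : 0 < a) (haL : a ≤ TL) (haR : a ≤ TR) :
    ∃ C : ℝ, ∀ M : ℕ, 2 ≤ M → ∀ E : Fin N → ℝ,
      Integrable (fun w => (M * timeNoise f TL TR a b M E w) ^ 6) (noiseLaw M) ∧
        ∫ w, (M * timeNoise f TL TR a b M E w) ^ 6 ∂noiseLaw M ≤ C := by
  have hr := hf.pos a a ha ha
  set r := f a a with hr_def
  have hm := expSixthMoment_nonneg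
  refine ⟨32 * ((1 / r) ^ 6 * expSixthMoment + (1 / r) ^ 6), fun M hM E => ?_⟩
  have := isProbabilityMeasure_noiseLaw hM
  have hM0 : (0 : ℝ) < M := by positivity
  by_cases hE : E ∈ box N a b
  swap
  · have : 0 ≤ 32 * ((1 / r) ^ 6 * expSixthMoment + (1 / r) ^ 6) := by positivity
    simpa [timeNoise, hE] using this
  obtain ⟨i2, m2⟩ := integral_holdExp_pow_six hM
  have hH := ((i2.const_mul ((1 / r) ^ 6)).add (integrable_const ((1 / r) ^ 6))).const_mul 32
  have hle : ∀ᵐ w ∂noiseLaw M, (M * timeNoise f TL TR a b M E w) ^ 6 ≤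
      32 * ((1 / r) ^ 6 * holdExp w ^ 6 + (1 / r) ^ 6) := by
    filter_upwards [ae_noiseLaw_mem_Ioo hM] with w hw
    have he := holdExp_pos hw
    have hR : r ≤ totalRate f TL TR E := le_totalRate hf ha haL haR fun i => (mem_box.1 hE i).1
    have hR0 := hr.trans_le hR
    have habs : |M * timeNoise f TL TR a b M E w| ≤ 1 / r * holdExp w + 1 / r := by
      have h1 : M * timeNoise f TL TR a b M E w =
          1 / totalRate f TL TR E * holdExp w - 1 / totalRate f TL TR E := by
        rw [timeNoise, if_pos hE]
        field_simp
      rw [h1]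
      refine (abs_sub _ _).trans ?_
      rw [abs_of_pos (by positivity), abs_of_pos (by positivity)]
      gcongr
    refine (pow_six_le_of_abs_le_add (by positivity) (by positivity) habs).trans_eq ?_
    rw [mul_pow (1 / r : ℝ)]
  have hmeas : Measurable fun w => (M * timeNoise f TL TR a b M E w) ^ 6 :=
    (((measurable_timeNoise hfm a b M).comp measurable_prodMk_left).const_mul _).pow_const 6
  have hint := hH.mono' hmeas.aestronglyMeasurable (by
    filter_upwards [hle] with w h
    rwa [Real.norm_of_nonneg (by positivity)])
  refine ⟨hint, (integral_mono_ae hint hH hle).trans_eq ?_⟩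
  refine (integral_const_mul _ _).trans ?_
  congr 1
  refine (integral_add (i2.const_mul _) (integrable_const _)).trans ?_
  rw [integral_const_mul, m2]
  simp

end SixthMoments

/-! ### Sixth moments of sums of centred noise along a driven process -/

section MartingaleMoments

/-- The linear term is kept exact, since it averages to zero for centred `d`; the other mixed terms
are absorbed by an explicit sum of squares. -/
lemma add_pow_six_le (s d : ℝ) :
    (s + d) ^ 6 ≤ s ^ 6 + 6 * s ^ 5 * d + 39 * (s ^ 4 * d ^ 2 + d ^ 6) := by
  have h : s ^ 6 + 6 * s ^ 5 * d + 39 * (s ^ 4 * d ^ 2 + d ^ 6) - (s + d) ^ 6 =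
      d ^ 2 * (10 * (s * (s - d)) ^ 2 + 3 * (d * (s - d)) ^ 2 + 14 * (s ^ 2 - d ^ 2) ^ 2 +
        21 * d ^ 4) := by
    ring
  rw [← sub_nonneg, h]
  positivity

/-- With `d = y / m`, the inequality u²v ≤ u³ + v³ for u = s², v = 1/m turns `s ^ 4 * d ^ 2` into
relative growth of order 1/m plus a source of order m⁻⁴. The constant 78 is 2 · 39. -/
lemma add_div_pow_six_le {m : ℝ} (hm : 1 ≤ m) (s y : ℝ) :
    (s + y / m) ^ 6 ≤
      s ^ 6 + 6 * s ^ 5 * (y / m) + 78 * (s ^ 6 / m + 1 / m ^ 4) * (1 + y ^ 6) := by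
  have hm0 : 0 < m := by linarith
  refine (add_pow_six_le s (y / m)).trans ?_
  have hy : y ^ 2 ≤ 1 + y ^ 6 := by
    nlinarith [sq_nonneg (y ^ 2 - 1), sq_nonneg y, sq_nonneg (y * (y ^ 2 - 1))]
  have hs : s ^ 4 * (1 / m) ≤ s ^ 6 + (1 / m) ^ 3 := by
    set u := s ^ 2 with hu
    set v := 1 / m with hv
    have hu0 : 0 ≤ u := by positivity
    have hv0 : 0 ≤ v := by positivity
    have h4 : s ^ 4 = u ^ 2 := by rw [hu]; ring
    have h6 : s ^ 6 = u ^ 3 := by rw [hu]; ring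
    rw [h4, h6]
    rcases le_total u v with h | h
    · nlinarith [mul_nonneg hu0 hu0, mul_le_mul h h hu0 hv0, pow_nonneg hu0 3]
    · nlinarith [mul_le_mul_of_nonneg_left h (mul_nonneg hu0 hu0), pow_nonneg hv0 3]
  have h1 : s ^ 4 * (y / m) ^ 2 ≤ (s ^ 6 / m + 1 / m ^ 4) * (1 + y ^ 6) := by
    have e1 : s ^ 4 * (y / m) ^ 2 = (s ^ 4 * (1 / m)) * (1 / m) * y ^ 2 := by field_simp
    have e2 : s ^ 6 / m + 1 / m ^ 4 = (s ^ 6 + (1 / m) ^ 3) * (1 / m) := by field_simp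
    rw [e1, e2]
    gcongr
  have h2 : (y / m) ^ 6 ≤ (s ^ 6 / m + 1 / m ^ 4) * (1 + y ^ 6) := by
    have e1 : (y / m) ^ 6 = 1 / m ^ 6 * y ^ 6 := by field_simp
    rw [e1]
    have h3 : 1 / m ^ 6 ≤ 1 / m ^ 4 := one_div_le_one_div_of_le (by positivity)
      (pow_le_pow_right₀ hm (by norm_num))
    have h4 : 0 ≤ s ^ 6 / m := by positivity
    exact mul_le_mul (by linarith) (by linarith) (by positivity) (by positivity)
  linarith

/-- Centring removes the term `6 s⁵ d`. This is the conditional one-step estimate, for a frozen past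
value `s`. -/
lemma lintegral_add_pow_six_le {W : Type*} [MeasurableSpace W] {ν : Measure W}
    [IsProbabilityMeasure ν] {d : W → ℝ} (hd : Measurable d) {m C : ℝ} (hm : 1 ≤ m) (s : ℝ)
    (h0 : ∫ w, d w ∂ν = 0) (hi : Integrable (fun w => (m * d w) ^ 6) ν)
    (hC : ∫ w, (m * d w) ^ 6 ∂ν ≤ C) :
    ∫⁻ w, ENNReal.ofReal ((s + d w) ^ 6) ∂ν ≤
      ENNReal.ofReal (s ^ 6 + 78 * (1 + C) * (s ^ 6 / m + 1 / m ^ 4)) := by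
  have hm0 : 0 < m := by linarith
  have hd1 : Integrable d ν := by
    refine (hi.add (integrable_const (1 : ℝ))).mono' hd.aestronglyMeasurable ?_
    refine Eventually.of_forall fun w => ?_
    have h1 : |d w| ≤ |m * d w| := by
      rw [abs_mul, abs_of_pos hm0]
      exact le_mul_of_one_le_left (abs_nonneg _) hm
    have h2 : |m * d w| ≤ (m * d w) ^ 6 + 1 := by
      set x := m * d w
      have h : |x| ^ 6 = x ^ 6 := by rw [pow_abs, abs_of_nonneg (by positivity)]
      rw [← h]
      rcases le_total |x| 1 with h | h
      · linarith [pow_nonneg (abs_nonneg x) 6]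
      · linarith [le_self_pow₀ h (by norm_num : 6 ≠ 0)]
    exact h1.trans h2
  set q := s ^ 6 / m + 1 / m ^ 4 with hq
  have hq0 : 0 ≤ q := by positivity
  have hI := ((integrable_const (s ^ 6)).add (hd1.const_mul (6 * s ^ 5))).add
    (((integrable_const (1 : ℝ)).add hi).const_mul (78 * q))
  have hle : ∀ w, (s + d w) ^ 6 ≤
      s ^ 6 + 6 * s ^ 5 * d w + 78 * q * (1 + (m * d w) ^ 6) := by
    intro w
    have := add_div_pow_six_le hm s (m * d w)
    rwa [mul_div_cancel_left₀ _ hm0.ne'] at this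
  calc ∫⁻ w, ENNReal.ofReal ((s + d w) ^ 6) ∂ν
      ≤ ∫⁻ w, ENNReal.ofReal (s ^ 6 + 6 * s ^ 5 * d w + 78 * q * (1 + (m * d w) ^ 6)) ∂ν :=
        lintegral_mono fun w => ENNReal.ofReal_le_ofReal (hle w)
    _ = ENNReal.ofReal (∫ w, (s ^ 6 + 6 * s ^ 5 * d w + 78 * q * (1 + (m * d w) ^ 6)) ∂ν) :=
        (ofReal_integral_eq_lintegral_ofReal hI (Eventually.of_forall fun w =>
          le_trans (by positivity) (hle w))).symm
    _ ≤ _ := by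
        refine ENNReal.ofReal_le_ofReal ?_
        have e : ∫ w, (s ^ 6 + 6 * s ^ 5 * d w + 78 * q * (1 + (m * d w) ^ 6)) ∂ν =
            s ^ 6 + 78 * q * (1 + ∫ w, (m * d w) ^ 6 ∂ν) := by
          refine (integral_add ((integrable_const (s ^ 6)).add (hd1.const_mul (6 * s ^ 5)))
            (((integrable_const (1 : ℝ)).add hi).const_mul (78 * q))).trans ?_
          congr 1
          · refine (integral_add (integrable_const _) (hd1.const_mul _)).trans ?_
            rw [integral_const_mul, h0]
            simp
          · refine (integral_const_mul _ _).trans ?_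
            congr 1
            refine (integral_add (integrable_const _) hi).trans ?_
            simp
        rw [e]
        have := mul_le_mul_of_nonneg_left hC (mul_nonneg (by norm_num : (0 : ℝ) ≤ 78) hq0)
        linarith

variable {Ω : Type*} [MeasurableSpace Ω] {P : Measure Ω}

/-- A process which is driven by independent noise is, at each time, a measurable function of the
past noise, hence independent of the present one. -/
lemma indepFun_of_driven {ι α : Type*} [Fintype ι] [DecidableEq ι] [MeasurableSpace α]
    {ξ : ℕ → ι → Ω → ℝ} (hm : ∀ n s, AEMeasurable (ξ n s) P)
    (hind : iIndepFun (fun x : ℕ × ι => ξ x.1 x.2) P) {g : α → (ι → ℝ) → α}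
    (hg : Measurable (Function.uncurry g)) {Z : ℕ → Ω → α} {z : α} (hZ0 : ∀ ω, Z 0 ω = z)
    (hZ : ∀ n ω, Z (n + 1) ω = g (Z n ω) (fun s => ξ n s ω)) (n : ℕ) :
    AEMeasurable (Z n) P ∧ IndepFun (Z n) (fun ω s => ξ n s ω) P := by
  -- The past is recorded as a function of finitely many coordinates, so that it can be separated
  -- from the coordinates of step `n` by disjointness.
  have key : ∀ n, ∃ φ : ((x : (Finset.range n ×ˢ Finset.univ : Finset (ℕ × ι))) → ℝ) → α,
      Measurable φ ∧ ∀ ω, Z n ω = φ fun x => ξ x.1.1 x.1.2 ω := by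
    intro n
    induction n with
    | zero => exact ⟨fun _ => z, measurable_const, hZ0⟩
    | succ n ih =>
      obtain ⟨φ, hφ, hφZ⟩ := ih
      have hold : ∀ x : (Finset.range n ×ˢ Finset.univ : Finset (ℕ × ι)),
          x.1 ∈ (Finset.range (n + 1) ×ˢ Finset.univ : Finset (ℕ × ι)) := fun x => by
        have := x.2
        simp only [Finset.mem_product, Finset.mem_range, Finset.mem_univ, and_true] at this ⊢
        omega
      have hnew : ∀ s : ι, (n, s) ∈ (Finset.range (n + 1) ×ˢ Finset.univ : Finset (ℕ × ι)) :=
        fun s => by simp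
      refine ⟨fun v => g (φ fun x => v ⟨x.1, hold x⟩) (fun s => v ⟨(n, s), hnew s⟩), ?_, ?_⟩
      · refine hg.comp (Measurable.prodMk (hφ.comp ?_) ?_)
        · exact measurable_pi_iff.2 fun x => measurable_pi_apply _
        · exact measurable_pi_iff.2 fun x => measurable_pi_apply _
      · intro ω
        rw [hZ, hφZ]
  obtain ⟨φ, hφ, hφZ⟩ := key n
  have hZeq : Z n = φ ∘ fun ω (x : (Finset.range n ×ˢ Finset.univ : Finset (ℕ × ι))) =>
      ξ x.1.1 x.1.2 ω := funext hφZ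
  refine ⟨?_, ?_⟩
  · rw [hZeq]
    exact hφ.comp_aemeasurable (aemeasurable_pi_iff.2 fun x => hm _ _)
  · have hdisj : Disjoint (Finset.range n ×ˢ Finset.univ : Finset (ℕ × ι))
        ({n} ×ˢ Finset.univ) := by
      rw [Finset.disjoint_left]
      intro x h1 h2
      simp only [Finset.mem_product, Finset.mem_range, Finset.mem_singleton] at h1 h2
      omega
    have h := hind.indepFun_finset₀ _ _ hdisj fun x => hm x.1 x.2
    have hψ : Measurable fun (v : ({n} ×ˢ Finset.univ : Finset (ℕ × ι)) → ℝ) (s : ι) =>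
        v ⟨(n, s), by simp⟩ := measurable_pi_iff.2 fun s => measurable_pi_apply _
    rw [hZeq]
    exact h.comp hφ hψ

/-- The sum of the noise terms `d (X m) (w m)`, `m < n`, has sixth moment of order `m⁻³`, if the
terms are centred and of order `m⁻¹` and their number is of order `m`. -/
lemma lintegral_sum_pow_six_le [IsProbabilityMeasure P] {ι α : Type*} [Fintype ι] [DecidableEq ι]
    [MeasurableSpace α] {ξ : ℕ → ι → Ω → ℝ} (hm : ∀ n s, AEMeasurable (ξ n s) P)
    (hind : iIndepFun (fun x : ℕ × ι => ξ x.1 x.2) P)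
    {ν : Measure (ι → ℝ)} [IsProbabilityMeasure ν] (hν : ∀ n, P.map (fun ω s => ξ n s ω) = ν)
    {g : α → (ι → ℝ) → α} (hg : Measurable (Function.uncurry g)) {X : ℕ → Ω → α} {z : α}
    (hX0 : ∀ ω, X 0 ω = z) (hX : ∀ n ω, X (n + 1) ω = g (X n ω) (fun s => ξ n s ω))
    {d : α → (ι → ℝ) → ℝ} (hd : Measurable (Function.uncurry d)) {M C : ℝ} (hM : 1 ≤ M)
    (hC0 : 0 ≤ C) (h0 : ∀ x, ∫ w, d x w ∂ν = 0)
    (hC : ∀ x, Integrable (fun w => (M * d x w) ^ 6) ν ∧ ∫ w, (M * d x w) ^ 6 ∂ν ≤ C) (n : ℕ) :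
    AEMeasurable (fun ω => ∑ m ∈ Finset.range n, d (X m ω) (fun s => ξ m s ω)) P ∧
    ∫⁻ ω, ENNReal.ofReal ((∑ m ∈ Finset.range n, d (X m ω) (fun s => ξ m s ω)) ^ 6) ∂P ≤
      ENNReal.ofReal (((1 + 78 * (1 + C) / M) ^ n - 1) / M ^ 3) := by
  have hM0 : 0 < M := by linarith
  set S : ℕ → Ω → ℝ := fun n ω => ∑ m ∈ Finset.range n, d (X m ω) (fun s => ξ m s ω) with hS
  -- The state is enlarged by the running sum: the pair is again driven by the noise, hence
  -- independent of the next step as a whole.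
  set Z : ℕ → Ω → α × ℝ := fun n ω => (X n ω, S n ω) with hZ
  have hgd : Measurable (Function.uncurry fun (p : α × ℝ) (w : ι → ℝ) =>
      (g p.1 w, p.2 + d p.1 w)) := by
    have h1 : Measurable fun q : (α × ℝ) × (ι → ℝ) => (q.1.1, q.2) := by fun_prop
    exact (hg.comp h1).prodMk ((measurable_snd.comp measurable_fst).add (hd.comp h1))
  have hdrive := indepFun_of_driven hm hind hgd (Z := Z) (z := (z, 0))
    (fun ω => by simp [hZ, hS, hX0])
    (fun n ω => by simp only [hZ, hS, hX, Finset.sum_range_succ])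
  refine ⟨measurable_snd.comp_aemeasurable (hdrive n).1, ?_⟩
  change ∫⁻ ω, ENNReal.ofReal (S n ω ^ 6) ∂P ≤ _
  induction n with
  | zero => simp [hS]
  | succ n ih =>
    obtain ⟨hZm, hZi⟩ := hdrive n
    have hwm : AEMeasurable (fun ω s => ξ n s ω) P := aemeasurable_pi_iff.2 fun s => hm n s
    set κ := 78 * (1 + C) with hκ
    have hκ0 : 0 ≤ κ := by positivity
    have hG : Measurable fun q : (α × ℝ) × (ι → ℝ) =>
        ENNReal.ofReal ((q.1.2 + d q.1.1 q.2) ^ 6) := by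
      have h1 : Measurable fun q : (α × ℝ) × (ι → ℝ) => (q.1.1, q.2) := by fun_prop
      exact (((measurable_snd.comp measurable_fst).add (hd.comp h1)).pow_const 6).ennreal_ofReal
    have hS6 : AEMeasurable (fun ω => ENNReal.ofReal (S n ω ^ 6)) P :=
      ((measurable_snd.comp_aemeasurable hZm).pow_const 6).ennreal_ofReal
    have hB1 : 0 ≤ 1 + κ / M := by positivity
    have hB : 1 ≤ (1 + κ / M) ^ n := one_le_pow₀ (by linarith [div_nonneg hκ0 hM0.le])
    -- The claimed bound solves u_{n+1} = (1 + κ/M) u_n + κ/M⁴ with u_0 = 0. Independence and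
    -- Tonelli reduce the step to the one-step estimate; working in `ENNReal` avoids any prior
    -- integrability of `S n`.
    calc ∫⁻ ω, ENNReal.ofReal (S (n + 1) ω ^ 6) ∂P
        = ∫⁻ ω, ENNReal.ofReal (((Z n ω).2 + d (Z n ω).1 fun s => ξ n s ω) ^ 6) ∂P := by
          simp only [hZ, hS, Finset.sum_range_succ]
      _ = ∫⁻ q, ENNReal.ofReal ((q.1.2 + d q.1.1 q.2) ^ 6) ∂(P.map (Z n)).prod ν := by
          rw [← hν n, ← (indepFun_iff_map_prod_eq_prod_map_map hZm hwm).1 hZi,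
            lintegral_map' hG.aemeasurable (hZm.prodMk hwm)]
      _ = ∫⁻ p, ∫⁻ w, ENNReal.ofReal ((p.2 + d p.1 w) ^ 6) ∂ν ∂(P.map (Z n)) :=
          lintegral_prod _ hG.aemeasurable
      _ ≤ ∫⁻ p, ENNReal.ofReal (p.2 ^ 6 + κ * (p.2 ^ 6 / M + 1 / M ^ 4)) ∂(P.map (Z n)) :=
          lintegral_mono fun p => lintegral_add_pow_six_le (hd.comp measurable_prodMk_left) hM p.2
            (h0 p.1) (hC p.1).1 (hC p.1).2
      _ = ∫⁻ ω, ENNReal.ofReal (S n ω ^ 6 + κ * (S n ω ^ 6 / M + 1 / M ^ 4)) ∂P :=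
          lintegral_map' (by fun_prop) hZm
      _ = ∫⁻ ω, (ENNReal.ofReal (1 + κ / M) * ENNReal.ofReal (S n ω ^ 6) +
            ENNReal.ofReal (κ / M ^ 4)) ∂P := by
          refine lintegral_congr fun ω => ?_
          rw [← ENNReal.ofReal_mul hB1, ← ENNReal.ofReal_add (by positivity) (by positivity)]
          congr 1
          ring
      _ = ENNReal.ofReal (1 + κ / M) * ∫⁻ ω, ENNReal.ofReal (S n ω ^ 6) ∂P +
            ENNReal.ofReal (κ / M ^ 4) := by
          rw [lintegral_add_right _ measurable_const, lintegral_const_mul'' _ hS6]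
          simp
      _ ≤ ENNReal.ofReal (1 + κ / M) * ENNReal.ofReal (((1 + κ / M) ^ n - 1) / M ^ 3) +
            ENNReal.ofReal (κ / M ^ 4) := by gcongr
      _ = _ := by
          rw [← ENNReal.ofReal_mul hB1, ← ENNReal.ofReal_add
            (mul_nonneg hB1 (div_nonneg (by linarith) (by positivity))) (by positivity)]
          congr 1
          have : κ / M ^ 4 = κ / M / M ^ 3 := by field_simp
          rw [this]
          ring

end MartingaleMoments

/-! ### Union bound and Borel–Cantelli -/

section BorelCantelli

variable {Ω : Type*} [MeasurableSpace Ω] {P : Measure Ω}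

/-- Markov's inequality for the sixth power of each sum, then a plain union bound instead of a
maximal inequality. -/
lemma measure_exists_lt_abs_le {S : ℕ → Ω → ℝ} {n₀ : ℕ} {B η : ℝ} (hη : 0 < η)
    (hS : ∀ n, AEMeasurable (S n) P)
    (hB : ∀ n ≤ n₀, ∫⁻ ω, ENNReal.ofReal (S n ω ^ 6) ∂P ≤ ENNReal.ofReal B) :
    P {ω | ∃ n ≤ n₀, η < |S n ω|} ≤ ENNReal.ofReal ((n₀ + 1) * (B / η ^ 6)) := by
  have hη6 : 0 < η ^ 6 := by positivity
  have hsub : {ω | ∃ n ≤ n₀, η < |S n ω|} ⊆ ⋃ n ∈ Finset.range (n₀ + 1),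
      {ω | ENNReal.ofReal (η ^ 6) ≤ ENNReal.ofReal (S n ω ^ 6)} := by
    rintro ω ⟨n, hn, h⟩
    refine Set.mem_biUnion (Finset.mem_coe.2 (Finset.mem_range.2 (Nat.lt_succ_of_le hn))) ?_
    refine ENNReal.ofReal_le_ofReal ?_
    have h1 : S n ω ^ 6 = |S n ω| ^ 6 := by rw [pow_abs, abs_of_nonneg (by positivity)]
    rw [h1]
    exact pow_le_pow_left₀ hη.le h.le 6
  refine (measure_mono hsub).trans ((measure_biUnion_finset_le _ _).trans ?_)
  have hone : ∀ n ∈ Finset.range (n₀ + 1),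
      P {ω | ENNReal.ofReal (η ^ 6) ≤ ENNReal.ofReal (S n ω ^ 6)} ≤
        ENNReal.ofReal (B / η ^ 6) := by
    intro n hn
    refine (meas_ge_le_lintegral_div ((hS n).pow_const 6).ennreal_ofReal
      (ENNReal.ofReal_pos.2 hη6).ne' ENNReal.ofReal_ne_top).trans ?_
    rw [ENNReal.ofReal_div_of_pos hη6]
    gcongr
    exact hB n (Nat.lt_succ_iff.1 (Finset.mem_range.1 hn))
  refine (Finset.sum_le_card_nsmul _ _ _ hone).trans_eq ?_
  rw [Finset.card_range, nsmul_eq_mul, ENNReal.ofReal_mul (by positivity)]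
  congr 1
  rw [← ENNReal.ofReal_natCast]
  push_cast
  rfl

/-- Centred noise terms of order `M⁻¹`: almost surely, for all large `M`, the sums of up to `c M`
terms are small. -/
lemma ae_eventually_abs_sum_le [IsProbabilityMeasure P] {ι α : Type*} [Fintype ι] [DecidableEq ι]
    [MeasurableSpace α] {ξ : ℕ → ℕ → ι → Ω → ℝ} {ν : ℕ → Measure (ι → ℝ)}
    (hν1 : ∀ M, 2 ≤ M → IsProbabilityMeasure (ν M))
    (hm : ∀ M, 2 ≤ M → ∀ n s, AEMeasurable (ξ M n s) P)
    (hind : ∀ M, 2 ≤ M → iIndepFun (fun x : ℕ × ι => ξ M x.1 x.2) P)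
    (hν : ∀ M, 2 ≤ M → ∀ n, P.map (fun ω s => ξ M n s ω) = ν M)
    {g : α → (ι → ℝ) → α} (hg : Measurable (Function.uncurry g)) {X : ℕ → ℕ → Ω → α} {z : α}
    (hX0 : ∀ M ω, X M 0 ω = z) (hX : ∀ M n ω, X M (n + 1) ω = g (X M n ω) (fun s => ξ M n s ω))
    {d : ℕ → α → (ι → ℝ) → ℝ} (hd : ∀ M, Measurable (Function.uncurry (d M)))
    (h0 : ∀ M, 2 ≤ M → ∀ x, ∫ w, d M x w ∂ν M = 0) {C : ℝ}
    (hC : ∀ M, 2 ≤ M → ∀ x, Integrable (fun w => (M * d M x w) ^ 6) (ν M) ∧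
      ∫ w, (M * d M x w) ^ 6 ∂ν M ≤ C) (c : ℕ) {η : ℝ} (hη : 0 < η) :
    ∀ᵐ ω ∂P, ∀ᶠ M : ℕ in atTop, ∀ n ≤ c * M,
      |∑ m ∈ Finset.range n, d M (X M m ω) (fun s => ξ M m s ω)| ≤ η := by
  set κ := 78 * (1 + max C 0) with hκ
  have hκ0 : 0 ≤ κ := by positivity
  -- Requiring `2 ≤ M` empties the events for the `M` whose noise is not controlled.
  set s : ℕ → Set Ω := fun M => {ω | 2 ≤ M ∧ ∃ n ≤ c * M,
    η < |∑ m ∈ Finset.range n, d M (X M m ω) (fun s => ξ M m s ω)|} with hs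
  -- At most `(c + 1) M` sums, each with sixth moment at most `exp (κ c) / M³` because `(1 + κ/M) ^
  -- n ≤ exp (κ c)` for `n ≤ c M`.
  set A := (c + 1) * (Real.exp (κ * c) / η ^ 6) with hA
  have hbound : ∀ M, P (s M) ≤ ENNReal.ofReal (A * (1 / (M : ℝ) ^ 2)) := by
    intro M
    by_cases hM : 2 ≤ M
    swap
    · have : s M = ∅ := by
        rw [hs, Set.eq_empty_iff_forall_notMem]
        exact fun ω h => hM h.1
      simp [this]
    have hM1 : (1 : ℝ) ≤ M := by exact_mod_cast (by omega : 1 ≤ M)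
    have hM0 : (0 : ℝ) < M := by linarith
    have := hν1 M hM
    have hmom := lintegral_sum_pow_six_le (hm M hM) (hind M hM) (hν M hM) hg (hX0 M) (hX M) (hd M)
      hM1 (le_max_right C 0) (h0 M hM)
      (fun x => ⟨(hC M hM x).1, (hC M hM x).2.trans (le_max_left _ _)⟩)
    have hsub : s M ⊆ {ω | ∃ n ≤ c * M,
        η < |∑ m ∈ Finset.range n, d M (X M m ω) (fun s => ξ M m s ω)|} := fun ω h => h.2
    refine (measure_mono hsub).trans ((measure_exists_lt_abs_le (n₀ := c * M)
      (B := Real.exp (κ * c) / (M : ℝ) ^ 3) hη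
      (fun n => (hmom n).1) fun n hn => (hmom n).2.trans (ENNReal.ofReal_le_ofReal ?_)).trans
      (ENNReal.ofReal_le_ofReal ?_))
    · refine div_le_div_of_nonneg_right ?_ (by positivity)
      have h1 : (1 + κ / M) ^ n ≤ Real.exp (κ / M) ^ n :=
        pow_le_pow_left₀ (by positivity) (by linarith [Real.add_one_le_exp (κ / M)]) n
      have h2 : Real.exp (κ / M) ^ n ≤ Real.exp (κ * c) := by
        rw [← Real.exp_nat_mul, Real.exp_le_exp]
        have h3 : (n : ℝ) ≤ c * M := by exact_mod_cast hn
        calc (n : ℝ) * (κ / M) ≤ c * M * (κ / M) := by gcongr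
          _ = κ * c := by field_simp
      linarith
    · have h1 : ((c * M : ℕ) : ℝ) + 1 ≤ (c + 1) * M := by push_cast; linarith
      calc (((c * M : ℕ) : ℝ) + 1) * (Real.exp (κ * c) / (M : ℝ) ^ 3 / η ^ 6)
          ≤ ((c + 1) * M) * (Real.exp (κ * c) / (M : ℝ) ^ 3 / η ^ 6) := by gcongr
        _ = A * (1 / (M : ℝ) ^ 2) := by rw [hA]; field_simp
  have hsum : Summable fun M : ℕ => A * (1 / (M : ℝ) ^ 2) :=
    (Real.summable_one_div_nat_pow.2 (by norm_num)).mul_left A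
  have hfin : ∑' M, P (s M) ≠ ⊤ :=
    ((ENNReal.tsum_le_tsum hbound).trans_lt hsum.tsum_ofReal_lt_top).ne
  filter_upwards [ae_eventually_notMem hfin] with ω hω
  filter_upwards [hω, eventually_ge_atTop 2] with M h1 h2 n hn
  by_contra hcon
  exact h1 ⟨h2, n, hn, not_le.1 hcon⟩

end BorelCantelli

/-! ### The law of large numbers for a measurable rate -/

section Limit

variable {N : ℕ} {f : ℝ → ℝ → ℝ} {TL TR : ℝ}

lemma IsNoise.ae_mem_Ioo {Ω : Type*} [MeasurableSpace Ω] {P : Measure Ω} {M : ℕ}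
    {ξ : ℕ → Source → Ω → ℝ} (h : IsNoise P M ξ) :
    ∀ᵐ ω ∂P, ∀ n s, ξ n s ω ∈ Set.Ioo (0 : ℝ) 1 := by
  simp only [ae_all_iff]
  intro n s
  refine ae_of_ae_map (h.hasLaw n s).aemeasurable ?_
  rw [(h.hasLaw n s).map_eq]
  exact Source.ae_law_mem_Ioo M s

lemma IsNoise.map_eq {Ω : Type*} [MeasurableSpace Ω] {P : Measure Ω} [IsProbabilityMeasure P]
    {M : ℕ} {ξ : ℕ → Source → Ω → ℝ} (h : IsNoise P M ξ) (n : ℕ) :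
    P.map (fun ω s => ξ n s ω) = noiseLaw M := by
  have hi : iIndepFun (fun s => ξ n s) P :=
    h.indep.precomp (g := fun s : Source => (n, s)) (Prod.mk_right_injective n)
  rw [(iIndepFun_iff_map_fun_eq_pi_map fun s => (h.hasLaw n s).aemeasurable).1 hi, noiseLaw]
  congr 1
  funext s
  exact (h.hasLaw n s).map_eq

/-- The law of large numbers for a rate function which is measurable on the whole plane. -/
theorem ae_tendstoUniformlyOn_of_measurable (hf : IsRateFunction f)
    (hfm : Measurable (Function.uncurry f)) (hTL : 0 < TL) (hTR : 0 < TR) {E₀ : Fin N → ℝ}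
    (hE₀ : ∀ i, 0 < E₀ i) {Ω : Type*} [MeasurableSpace Ω] {P : Measure Ω} [IsProbabilityMeasure P]
    {ξ : ℕ → ℕ → Source → Ω → ℝ} (hξ : ∀ M : ℕ, 2 ≤ M → IsNoise P M (ξ M)) {T : ℝ} (hT : 0 < T)
    {θ : ℝ → Fin N → ℝ} (hθ : IsSolution f TL TR E₀ T θ) :
    ∀ᵐ ω ∂P, TendstoUniformlyOn
      (fun (M : ℕ) (t : ℝ) => fastProcess f TL TR E₀ M (fun n s => ξ M n s ω) t)
      θ atTop (Set.Icc 0 T) := by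
  obtain ⟨a, b, ha, haL, haR, c, htrack⟩ := hθ.exists_tracking hf hTL hTR hE₀ hT
  have hgood : ∀ᵐ ω ∂P, ∀ M, 2 ≤ M → ∀ n s, ξ M n s ω ∈ Set.Ioo (0 : ℝ) 1 := by
    simp only [ae_all_iff]
    intro M hM
    simpa only [ae_all_iff] using (hξ M hM).ae_mem_Ioo
  have hstep : Measurable (Function.uncurry fun (E : Fin N → ℝ) (w : Source → ℝ) =>
      E + increment f TL TR E w) := measurable_fst.add (measurable_increment hfm)
  -- Countably many thresholds `1 / (k + 1)` give one null set that serves every `ε`.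
  have hmain : ∀ {d : ℕ → (Fin N → ℝ) → (Source → ℝ) → ℝ},
      (∀ M, Measurable (Function.uncurry (d M))) →
      (∀ M, 2 ≤ M → ∀ x, ∫ w, d M x w ∂noiseLaw M = 0) →
      (∃ C, ∀ M, 2 ≤ M → ∀ x, Integrable (fun w => (M * d M x w) ^ 6) (noiseLaw M) ∧
        ∫ w, (M * d M x w) ^ 6 ∂noiseLaw M ≤ C) →
      ∀ᵐ ω ∂P, ∀ k : ℕ, ∀ᶠ M : ℕ in atTop, ∀ n ≤ c * M,
        |∑ m ∈ Finset.range n, d M (jumpChain f TL TR E₀ (fun n s => ξ M n s ω) m)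
          (fun s => ξ M m s ω)| ≤ 1 / ((k : ℝ) + 1) := by
    rintro d hd h0 ⟨C, hC⟩
    rw [ae_all_iff]
    intro k
    exact ae_eventually_abs_sum_le (fun M hM => isProbabilityMeasure_noiseLaw hM)
      (fun M hM n s => ((hξ M hM).hasLaw n s).aemeasurable) (fun M hM => (hξ M hM).indep)
      (fun M hM => (hξ M hM).map_eq) hstep
      (X := fun M n ω => jumpChain f TL TR E₀ (fun n s => ξ M n s ω) n)
      (fun _ _ => rfl) (fun _ _ _ => rfl) hd h0 hC c (by positivity)
  have henergy := ae_all_iff.2 fun i : Fin N => hmain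
    (d := fun M => energyNoise f TL TR a b M i)
    (fun M => measurable_energyNoise hfm a b M i)
    (fun M hM => integral_energyNoise hf hTL hTR ha hM i)
    ((exists_energyNoise_sixth_moment_le (b := b) hf hfm ha haL haR).imp
      fun C h M hM => h M hM i)
  have htime := hmain (d := fun M => timeNoise f TL TR a b M)
    (fun M => measurable_timeNoise hfm a b M) (fun M hM => integral_timeNoise hM)
    (exists_timeNoise_sixth_moment_le hf hfm ha haL haR)
  filter_upwards [hgood, henergy, htime] with ω h1 h2 h3
  rw [Metric.tendstoUniformlyOn_iff]
  intro ε hε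
  obtain ⟨η, hη, M₀, hM₀⟩ := htrack (ε / 2) (by linarith)
  obtain ⟨k, hk⟩ := exists_nat_one_div_lt hη
  filter_upwards [eventually_all.2 fun i => h2 i k, h3 k, eventually_ge_atTop M₀,
    eventually_ge_atTop 2] with M h4 h5 h6 h7 t ht
  rw [dist_comm]
  have := hM₀ M h6 (fun n s => ξ M n s ω) (h1 M h7) (fun i n hn => (h4 i n hn).trans hk.le)
    (fun n hn => (h5 n hn).trans hk.le) t ht
  linarith

end Limit

/-! ### Removing measurability: values of the rate off the open quadrant are irrelevant -/

section Extension

variable {N : ℕ} {f g : ℝ → ℝ → ℝ} {TL TR : ℝ}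

open Classical in
/-- The rate function, extended by `1` from the open quadrant to the plane. -/
def extendRate (f : ℝ → ℝ → ℝ) (x y : ℝ) : ℝ := if 0 < x ∧ 0 < y then f x y else 1

lemma extendRate_eq {x y : ℝ} (hx : 0 < x) (hy : 0 < y) : extendRate f x y = f x y :=
  if_pos ⟨hx, hy⟩

lemma IsRateFunction.extendRate (hf : IsRateFunction f) : IsRateFunction (extendRate f) where
  contDiffOn := hf.contDiffOn.congr fun p hp => extendRate_eq hp.1 hp.2
  pos x y hx hy := by rw [extendRate_eq hx hy]; exact hf.pos x y hx hy
  mono x x' y y' hx hy hxx hyy := by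
    rw [extendRate_eq hx hy, extendRate_eq (hx.trans_le hxx) (hy.trans_le hyy)]
    exact hf.mono x x' y y' hx hy hxx hyy
  bounded := hf.bounded.imp fun K hK x y hx hy => by
    rw [extendRate_eq hx hy]; exact hK x y hx hy

lemma IsRateFunction.measurable_extendRate (hf : IsRateFunction f) :
    Measurable (Function.uncurry (EnergyExchange.extendRate f)) := by
  classical
  have hs : MeasurableSet (Set.Ioi (0 : ℝ) ×ˢ Set.Ioi (0 : ℝ)) :=
    measurableSet_Ioi.prod measurableSet_Ioi
  have h := hf.contDiffOn.continuousOn.measurable_piecewise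
    (continuousOn_const (c := (1 : ℝ))) hs
  have e : Function.uncurry (EnergyExchange.extendRate f) =
      (Set.Ioi (0 : ℝ) ×ˢ Set.Ioi (0 : ℝ)).piecewise (Function.uncurry f) fun _ => 1 := by
    ext ⟨x, y⟩
    by_cases hxy : 0 < x ∧ 0 < y <;> simp [EnergyExchange.extendRate, Set.piecewise, hxy]
  rw [e]
  exact h

lemma clockRate_congr (hfg : ∀ x y, 0 < x → 0 < y → f x y = g x y) (hTL : 0 < TL) (hTR : 0 < TR)
    {E : Fin N → ℝ} (hE : ∀ i, 0 < E i) : clockRate f TL TR E = clockRate g TL TR E :=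
  funext fun _ => hfg _ _ (chain_pos hTL hTR hE _) (chain_pos hTL hTR hE _)

lemma totalRate_congr (hfg : ∀ x y, 0 < x → 0 < y → f x y = g x y) (hTL : 0 < TL) (hTR : 0 < TR)
    {E : Fin N → ℝ} (hE : ∀ i, 0 < E i) : totalRate f TL TR E = totalRate g TL TR E := by
  rw [totalRate, totalRate, clockRate_congr hfg hTL hTR hE]

open Classical in
lemma increment_congr (hfg : ∀ x y, 0 < x → 0 < y → f x y = g x y) (hTL : 0 < TL) (hTR : 0 < TR)
    {E : Fin N → ℝ} (hE : ∀ i, 0 < E i) (w : Source → ℝ) :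
    increment f TL TR E w = increment g TL TR E w := by
  have : ∀ u k, Chosen f TL TR E u k ↔ Chosen g TL TR E u k := by
    intro u k
    rw [Chosen, Chosen, clockRate_congr hfg hTL hTR hE, totalRate_congr hfg hTL hTR hE]
  funext i
  exact congrArg₂ (· - ·) (if_congr (this _ _) rfl rfl) (if_congr (this _ _) rfl rfl)

lemma drift_congr (hfg : ∀ x y, 0 < x → 0 < y → f x y = g x y) (hTL : 0 < TL) (hTR : 0 < TR)
    {E : Fin N → ℝ} (hE : ∀ i, 0 < E i) : drift f TL TR E = drift g TL TR E := by
  funext i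
  simp only [drift]
  rw [hfg _ _ (chain_pos hTL hTR hE _) (hE i), hfg _ _ (hE i) (chain_pos hTL hTR hE _)]

lemma IsSolution.congr (hfg : ∀ x y, 0 < x → 0 < y → f x y = g x y) (hTL : 0 < TL) (hTR : 0 < TR)
    {E₀ : Fin N → ℝ} {T : ℝ} {θ : ℝ → Fin N → ℝ} (hθ : IsSolution f TL TR E₀ T θ) :
    IsSolution g TL TR E₀ T θ where
  initial := hθ.initial
  pos := hθ.pos
  deriv t ht := by rw [← drift_congr hfg hTL hTR (hθ.pos t ht)]; exact hθ.deriv t ht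

/-- When all noise values lie in `(0, 1)`, the profiles stay positive and the rate is only ever
evaluated inside the quadrant. -/
lemma fastProcess_congr (hfg : ∀ x y, 0 < x → 0 < y → f x y = g x y) (hTL : 0 < TL) (hTR : 0 < TR)
    {E₀ : Fin N → ℝ} (hE₀ : ∀ i, 0 < E₀ i) {w : ℕ → Source → ℝ}
    (hw : ∀ n s, w n s ∈ Set.Ioo (0 : ℝ) 1) (M : ℕ) :
    fastProcess f TL TR E₀ M w = fastProcess g TL TR E₀ M w := by
  have hX : ∀ n, jumpChain f TL TR E₀ w n = jumpChain g TL TR E₀ w n := by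
    intro n
    induction n with
    | zero => rfl
    | succ n ih =>
      simp only [jumpChain, ← ih]
      rw [increment_congr hfg hTL hTR (jumpChain_pos hTL hTR hE₀ hw n)]
  have hτ : ∀ n, jumpTime f TL TR E₀ w n = jumpTime g TL TR E₀ w n := by
    intro n
    induction n with
    | zero => rfl
    | succ n ih =>
      simp only [jumpTime, ih, ← hX]
      rw [totalRate_congr hfg hTL hTR (jumpChain_pos hTL hTR hE₀ hw n)]
  funext t
  simp only [fastProcess, slowProcess, hX, hτ]

end Extension

end

end EnergyExchange

/-! ### The main theorem -/

theorem theorem1 {N : ℕ} (hN : 1 ≤ N) (f : ℝ → ℝ → ℝ) (hf : EnergyExchange.IsRateFunction f)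
    (TL TR : ℝ) (hTL : 0 < TL) (hTR : 0 < TR)
    (E₀ : Fin N → ℝ) (hE₀ : ∀ i, 0 < E₀ i)
    {Ω : Type*} [MeasurableSpace Ω] (P : Measure Ω) [IsProbabilityMeasure P]
    (ξ : ℕ → ℕ → EnergyExchange.Source → Ω → ℝ)
    (hξ : ∀ M : ℕ, 2 ≤ M → EnergyExchange.IsNoise P M (ξ M))
    (T : ℝ) (hT : 0 < T) :
    (∃ θ : ℝ → Fin N → ℝ, EnergyExchange.IsSolution f TL TR E₀ T θ) ∧
    ∀ θ : ℝ → Fin N → ℝ, EnergyExchange.IsSolution f TL TR E₀ T θ →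
      ∀ᵐ ω ∂P, TendstoUniformlyOn
        (fun (M : ℕ) (t : ℝ) =>
          EnergyExchange.fastProcess f TL TR E₀ M (fun n s => ξ M n s ω) t)
        θ atTop (Set.Icc 0 T) := by
  refine ⟨EnergyExchange.exists_isSolution hf hTL hTR hE₀ hT, fun θ hθ => ?_⟩
  have hfg : ∀ x y, 0 < x → 0 < y → f x y = EnergyExchange.extendRate f x y :=
    fun x y hx hy => (EnergyExchange.extendRate_eq hx hy).symm
  have hgood : ∀ᵐ ω ∂P, ∀ M, 2 ≤ M → ∀ n s, ξ M n s ω ∈ Set.Ioo (0 : ℝ) 1 := by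
    simp only [ae_all_iff]
    intro M hM
    simpa only [ae_all_iff] using (hξ M hM).ae_mem_Ioo
  filter_upwards [hgood, EnergyExchange.ae_tendstoUniformlyOn_of_measurable hf.extendRate
    hf.measurable_extendRate hTL hTR hE₀ hξ hT (hθ.congr hfg hTL hTR)] with ω h1 h2
  -- Almost surely the processes for `f` and for its measurable extension coincide for every `M ≥
  -- 2`, which suffices for the limit.
  refine h2.congr ?_
  filter_upwards [eventually_ge_atTop 2] with M hM t _
  exact congrFun (EnergyExchange.fastProcess_congr hfg hTL hTR hE₀ (h1 M hM) M).symm t
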